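/- **Setting.** For $\ell=1,\dots,p$ ($p\ge 1$) let $E_\ell$ be a finite-dimensional simple Euclidean Jordan algebra with product $\circ$, identity $e_\ell$, rank $r_\ell$ and inner product $\langle x,y\rangle=\operatorname{trace}(x\circ y)$. Every $x\in E_\ell$ has a spectral decomposition $x=\sum_{i=1}^{r_\ell}\lambda_i c_i$ with $c_1,\dots,c_{r_\ell}$ a Jordan frame (primitive idempotents, $c_i\circ c_j=0$ for $i\ne j$, $\sum_i c_i=e_\ell$). Put $E=E_1\times\dots\times E_p$, $e=(e_1,\dots,e_p)$, $r=\sum_\ell r_\ell$, $r_{\max}=\max_\ell r_\ell$, let $K=K_1\times\dots\times K_p$ with $K_\ell=\{w\circ w: w\in E_\ell\}$, let $\mathcal P_K$ be the projection onto $K$, $\lambda_{\min}(z)$ the smallest eigenvalue of any block of $z$, and $Q_g(x)=2g\circ(g\circ x)-(g\circ g)\circ x$. Let $\mathcal A:E\to\mathbb R^m$ be linear, $0<\xi<1$, $0<\varepsilon<1$. Let $P_{\mathcal A}$ be the orthogonal projection onto $\ker\mathcal A$. **Basic procedure** (input $P_{\mathcal A}$, $y^1$, $\xi$). For $k=1,2,\dots$,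 as long as $k\le p^2r_{\max}^2/\xi^2$: let $z=P_{\mathcal A}(y^k)$, $v=y^k-z$ and $v_\ell=\sum_i\lambda(v_\ell)_i\,c(v_\ell)_i$ (spectral decomposition of the $\ell$-th block). If $z\in\operatorname{int}K$, return $z$. If $z=0$ return $y^k$; if $v\in K\setminus\{0\}$ return $v$. Otherwise let $H_\ell$ be the set of indices $i$ such that $\lambda(v_\ell)_i>0$ (if $\langle v,e\rangle>0$), respectively $\lambda(v_\ell)_i<0$ (if $\langle v,e\rangle\le0$), and $\langle e,\mathcal P_K(-v/\lambda(v_\ell)_i)\rangle\le\xi$. If some $H_\ell\neq\emptyset$, return $(H_\ell)_\ell$ and the frames $(c(v_\ell)_i)_{i}$. Otherwise choose an idempotent $u$ with $\langle e,u\rangle=1$, $\langle z,u\rangle=\lambda_{\min}(z)$, and set $y^{k+1}=\alpha y^k+(1-\alpha)u$, $\alpha=\langle P_{\mathcal A}u,P_{\mathcal A}u-z\rangle/\|z-P_{\mathcal A}u\|^2$. If the loop is exhausted, return an error. **Main algorithm.** Initialize $m_\ell=0$, $\bar Q_\ell=RP_\ell=RD_\ell=\mathrm{id}$. Each iteration calls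 the basic procedure with $P_{\mathcal A}$ for the current $\mathcal A$, $y^1=\frac1re$ and $\xi$. If it returns $z$ (resp. $y$ or $v$), stop and return $RP\,z$ (resp. $RD\,y$ or $RD\,v$); if it returns an error, stop. If it returns $H_\ell$ and frames $(c_{\ell,i})_i$, then for every $\ell$ with $H_\ell\ne\emptyset$ put $g_\ell=\sqrt\xi\sum_{h\in H_\ell}c_{\ell,h}+\sum_{h\notin H_\ell}c_{\ell,h}$ and $g_\ell^{-1}=\frac1{\sqrt\xi}\sum_{h\in H_\ell}c_{\ell,h}+\sum_{h\notin H_\ell}c_{\ell,h}$, replace $RP_\ell$ by $RP_\ell Q_{g_\ell}$, $RD_\ell$ by $RD_\ell Q_{g_\ell^{-1}}$ and $m_\ell$ by $m_\ell+\langle\bar Q_\ell(\sum_{h\in H_\ell}c_{\ell,h}),e_\ell\rangle$; if then $\dfrac{r_\ell}{r_\ell+(\frac1\xi-1)m_\ell}\le\varepsilon$, stop and report that there is no $\varepsilon$-feasible solution; otherwise replace $\bar Q_\ell$ by $\bar Q_\ell Q_{g_\ell^{-1}}$. If the algorithm has not stopped, replace $\mathcal A$ by $\mathcal A\,Q$,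 where $Q$ acts as $Q_{g_\ell}$ on the blocks with $H_\ell\neq\emptyset$ and as the identity on the others, and start the next iteration. **Statement.** Write $T_\ell=\frac{\xi}{1-\xi}\left(\frac1\varepsilon-1\right)r_\ell$. 1. Every execution of the main algorithm terminates after at most $\sum_{\ell=1}^p\left(\lceil T_\ell\rceil-1\right)+1$ iterations. 2. If all $T_\ell$ are integers, or if $\varepsilon\le\varepsilon_0$ for a certain $\varepsilon_0>0$ that depends only on $\xi$ and on the algebras $E_1,\dots,E_p$ (not on $\mathcal A$), then every execution terminates after at most $$\frac{\xi}{1-\xi}\left(\frac1\varepsilon-1\right)r-p+1$$ iterations. 3. The bound in 2 is not polynomial in $\log(1/\varepsilon)$: for fixed $\xi$ and $E_1,\dots,E_p$ and every real polynomial $P$, one has $P(\log(1/\varepsilon))<\frac{\xi}{1-\xi}(\frac1\varepsilon-1)r-p+1$ for all sufficiently small $\varepsilon>0$. -/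

import Mathlib

noncomputable section

namespace SymCone

/-- A Euclidean Jordan algebra: a real inner product space with a commutative bilinear product with
identity, satisfying the Jordan identity, for which multiplications are self-adjoint. -/
class EuclideanJordanAlgebra (E : Type*) [NormedAddCommGroup E] [InnerProductSpace ℝ E] where
  /-- the Jordan product -/
  mul : E →ₗ[ℝ] E →ₗ[ℝ] E
  /-- the identity element -/
  one : E
  mul_comm : ∀ x y, mul x y = mul y x
  one_mul : ∀ x, mul one x = x
  jordan : ∀ x y, mul x (mul (mul x x) y) = mul (mul x x) (mul x y)
  inner_mul : ∀ x y z, inner ℝ (mul x y) z = inner ℝ y (mul x z)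

open EuclideanJordanAlgebra

section Algebra

variable {E : Type*} [NormedAddCommGroup E] [InnerProductSpace ℝ E] [EuclideanJordanAlgebra E]

def IsIdem (c : E) : Prop := mul c c = c

/-- A primitive idempotent: nonzero, and not the sum of two nonzero idempotents. -/
def IsPrimitive (c : E) : Prop :=
  IsIdem c ∧ c ≠ 0 ∧ ∀ a b : E, IsIdem a → IsIdem b → c = a + b → a = 0 ∨ b = 0

structure IsJordanFrame {k : ℕ} (c : Fin k → E) : Prop where
  primitive : ∀ i, IsPrimitive (c i)
  orth : ∀ i j, i ≠ j → mul (c i) (c j) = 0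
  sum_eq : ∑ i, c i = one

def pow (x : E) : ℕ → E
  | 0 => one
  | n + 1 => mul x (pow x n)

/-- The smallest `d` such that `e, x, …, x ^ d` are linearly dependent. -/
def degree (x : E) : ℕ :=
  sInf {d : ℕ | ¬ LinearIndependent ℝ (fun i : Fin (d + 1) => pow x i)}

variable (E) in
/-- The rank: the maximal degree of an element. -/
def rank : ℕ := sSup (Set.range (degree : E → ℕ))

/-- `x = ∑ lam i • c i` is a spectral decomposition of `x`: the `lam i` are its eigenvalues with
multiplicities and the `c i` form a Jordan frame, of size the rank. -/
def IsSpectral (x : E) (lam : Fin (rank E) → ℝ) (c : Fin (rank E) → E) : Prop :=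
  IsJordanFrame c ∧ x = ∑ i, lam i • c i

variable (E) in
/-- The inner product is the trace form: `⟨x, y⟩ = trace (x ∘ y)`, the trace being the sum of the
eigenvalues. -/
def InnerIsTrace : Prop :=
  ∀ (x y : E) (lam : Fin (rank E) → ℝ) (c : Fin (rank E) → E),
    IsSpectral (mul x y) lam c → inner ℝ x y = ∑ i, lam i

def IsIdeal (I : Submodule ℝ E) : Prop := ∀ x : E, ∀ y ∈ I, mul x y ∈ I

variable (E) in
/-- A nonzero algebra that is not a direct product of two nonzero Euclidean Jordan algebras; the
factors of a direct product are complementary ideals. -/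
def IsSimple : Prop :=
  Nontrivial E ∧
    ∀ I J : Submodule ℝ E, IsIdeal I → IsIdeal J → IsCompl I J → I = ⊥ ∨ J = ⊥

/-- The quadratic representation `Q_v (x) = 2 v ∘ (v ∘ x) - v² ∘ x`. -/
def quadRep (v : E) : E →ₗ[ℝ] E :=
  (2 : ℝ) • (mul v ∘ₗ mul v) - mul (mul v v)

/-- `t ∑_{h ∈ H} c_h + ∑_{h ∉ H} c_h`. For a Jordan frame `c` and `t ≠ 0`, its inverse is the same
expression with `t⁻¹` for `t`. -/
def scaling {k : ℕ} (t : ℝ) (H : Finset (Fin k)) (c : Fin k → E) : E :=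
  t • (∑ h ∈ H, c h) + ∑ h ∈ Hᶜ, c h

end Algebra

section Product

variable {p : ℕ} {E : Fin p → Type*} [∀ l, NormedAddCommGroup (E l)]
  [∀ l, InnerProductSpace ℝ (E l)] [∀ l, EuclideanJordanAlgebra (E l)]

variable (E) in
/-- The identity `e = (e₁, …, e_p)` of the product algebra. -/
def unit : PiLp 2 E := WithLp.toLp 2 (fun _ => one)

variable (E) in
/-- The symmetric cone `K = K₁ × ⋯ × K_p`, where `K_l` is the set of squares of `E_l`. -/
def cone : Set (PiLp 2 E) := {x | ∀ l, ∃ w : E l, x l = mul w w}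

/-- `q` is the projection of `x` onto the cone `K`. -/
def IsConeProj (x q : PiLp 2 E) : Prop :=
  q ∈ cone E ∧ ∀ w ∈ cone E, ‖x - q‖ ≤ ‖x - w‖

/-- `(Q₁, …, Q_p)` acting blockwise on the product. -/
def blockMap (Q : ∀ l, E l →ₗ[ℝ] E l) : PiLp 2 E →ₗ[ℝ] PiLp 2 E where
  toFun x := WithLp.toLp 2 (fun l => Q l (x l))
  map_add' x y := by ext l; simp
  map_smul' a x := by ext l; simp

variable (E) in
def totalRank : ℕ := ∑ l, rank (E l)

variable (E) in
def maxRank : ℕ := Finset.univ.sup (fun l => rank (E l))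

/-- Eigenvalues and primitive idempotents for a spectral decomposition of every block. -/
def IsBlockSpectral (x : PiLp 2 E) (lam : ∀ l, Fin (rank (E l)) → ℝ)
    (c : ∀ l, Fin (rank (E l)) → E l) : Prop :=
  ∀ l, IsSpectral (x l) (lam l) (c l)

open Classical in
/-- The index sets `H_l` computed by the basic procedure from `v` and the eigenvalues of `v`. -/
def cutSet (ξ : ℝ) (v : PiLp 2 E) (lam : ∀ l, Fin (rank (E l)) → ℝ) (l : Fin p) :
    Finset (Fin (rank (E l))) :=
  Finset.univ.filter fun i =>
    (if 0 < inner ℝ v (unit E) then 0 < lam l i else lam l i < 0) ∧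
      ∃ q, IsConeProj (-((1 / lam l i) • v)) q ∧ inner ℝ (unit E) q ≤ ξ

variable (E) in
/-- What the basic procedure can return. -/
inductive BPOutcome : Type _
  | primal (z : PiLp 2 E)
  | dual (w : PiLp 2 E)
  | cut (H : ∀ l, Finset (Fin (rank (E l)))) (C : ∀ l, Fin (rank (E l)) → E l)
  | failure

/-- The loop of the basic procedure (von Neumann scheme). `BPLoop P ξ k y o` means: entered with
counter `k` and iterate `y`, for the projection map `P` and the constant `ξ`, the loop can return
`o`. (Spectral decompositions and the idempotent `u` need not be unique, hence a relation.) -/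
inductive BPLoop (P : PiLp 2 E → PiLp 2 E) (ξ : ℝ) : ℕ → PiLp 2 E → BPOutcome E → Prop
  | exhausted (k : ℕ) (y : PiLp 2 E)
      (hk : ¬ (k : ℝ) ≤ (p : ℝ) ^ 2 * (maxRank E : ℝ) ^ 2 / ξ ^ 2) :
      BPLoop P ξ k y .failure
  | primal (k : ℕ) (y : PiLp 2 E)
      (hk : (k : ℝ) ≤ (p : ℝ) ^ 2 * (maxRank E : ℝ) ^ 2 / ξ ^ 2)
      (hz : P y ∈ interior (cone E)) :
      BPLoop P ξ k y (.primal (P y))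
  | dual_y (k : ℕ) (y : PiLp 2 E)
      (hk : (k : ℝ) ≤ (p : ℝ) ^ 2 * (maxRank E : ℝ) ^ 2 / ξ ^ 2)
      (hz : P y ∉ interior (cone E)) (h0 : P y = 0) :
      BPLoop P ξ k y (.dual y)
  | dual_v (k : ℕ) (y : PiLp 2 E)
      (hk : (k : ℝ) ≤ (p : ℝ) ^ 2 * (maxRank E : ℝ) ^ 2 / ξ ^ 2)
      (hz : P y ∉ interior (cone E)) (hv : y - P y ∈ cone E) (hv0 : y - P y ≠ 0) :
      BPLoop P ξ k y (.dual (y - P y))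
  | cut (k : ℕ) (y : PiLp 2 E) (lam : ∀ l, Fin (rank (E l)) → ℝ)
      (c : ∀ l, Fin (rank (E l)) → E l)
      (hk : (k : ℝ) ≤ (p : ℝ) ^ 2 * (maxRank E : ℝ) ^ 2 / ξ ^ 2)
      (hz : P y ∉ interior (cone E)) (h0 : P y ≠ 0)
      (hv : ¬ (y - P y ∈ cone E ∧ y - P y ≠ 0))
      (hdec : IsBlockSpectral (y - P y) lam c)
      (hH : ∃ l, (cutSet ξ (y - P y) lam l).Nonempty) :
      BPLoop P ξ k y (.cut (cutSet ξ (y - P y) lam) c)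
  | next (k : ℕ) (y u : PiLp 2 E) (lam : ∀ l, Fin (rank (E l)) → ℝ)
      (c : ∀ l, Fin (rank (E l)) → E l) (lamz : ∀ l, Fin (rank (E l)) → ℝ)
      (cz : ∀ l, Fin (rank (E l)) → E l) (α : ℝ) (o : BPOutcome E)
      (hk : (k : ℝ) ≤ (p : ℝ) ^ 2 * (maxRank E : ℝ) ^ 2 / ξ ^ 2)
      (hz : P y ∉ interior (cone E)) (h0 : P y ≠ 0)
      (hv : ¬ (y - P y ∈ cone E ∧ y - P y ≠ 0))
      (hdec : IsBlockSpectral (y - P y) lam c)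
      (hH : ∀ l, cutSet ξ (y - P y) lam l = ∅)
      (hdecz : IsBlockSpectral (P y) lamz cz)
      (hu : ∀ l, IsIdem (u l)) (hu1 : inner ℝ (unit E) u = (1 : ℝ))
      (humin : ∃ l i, inner ℝ (P y) u = lamz l i ∧ ∀ l' i', lamz l i ≤ lamz l' i')
      (hα : α = inner ℝ (P u) (P u - P y) / ‖P y - P u‖ ^ 2)
      (ho : BPLoop P ξ (k + 1) (α • y + (1 - α) • u) o) :
      BPLoop P ξ k y o

variable (E) in
/-- The variables of the main algorithm. -/
structure MainState (m : ℕ) where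
  A : PiLp 2 E →ₗ[ℝ] EuclideanSpace ℝ (Fin m)
  /-- the accumulated values `m_l` -/
  acc : Fin p → ℝ
  Qbar : ∀ l, E l →ₗ[ℝ] E l
  RP : ∀ l, E l →ₗ[ℝ] E l
  RD : ∀ l, E l →ₗ[ℝ] E l

def MainState.init {m : ℕ} (A : PiLp 2 E →ₗ[ℝ] EuclideanSpace ℝ (Fin m)) : MainState E m where
  A := A
  acc := fun _ => 0
  Qbar := fun _ => LinearMap.id
  RP := fun _ => LinearMap.id
  RD := fun _ => LinearMap.id

open Classical in
/-- The update of all variables after the basic procedure has returned index sets `H` and frames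
`C`; a block with `H_l = ∅` is left unchanged. -/
def MainState.update {m : ℕ} (ξ : ℝ) (s : MainState E m) (H : ∀ l, Finset (Fin (rank (E l))))
    (C : ∀ l, Fin (rank (E l)) → E l) : MainState E m where
  A := s.A ∘ₗ blockMap (fun l =>
    if (H l).Nonempty then quadRep (scaling (√ξ) (H l) (C l)) else LinearMap.id)
  acc := fun l =>
    if (H l).Nonempty then inner ℝ (s.Qbar l (∑ h ∈ H l, C l h)) one + s.acc l else s.acc l
  Qbar := fun l =>
    if (H l).Nonempty then s.Qbar l ∘ₗ quadRep (scaling (√ξ)⁻¹ (H l) (C l)) else s.Qbar l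
  RP := fun l =>
    if (H l).Nonempty then s.RP l ∘ₗ quadRep (scaling (√ξ) (H l) (C l)) else s.RP l
  RD := fun l =>
    if (H l).Nonempty then s.RD l ∘ₗ quadRep (scaling (√ξ)⁻¹ (H l) (C l)) else s.RD l

variable (E) in
/-- What the main algorithm can return. -/
inductive MainOutcome : Type _
  | primal (x : PiLp 2 E)
  | dual (w : PiLp 2 E)
  | noEpsFeasible
  | bpFailure

/-- The termination criterion `r_l / (r_l + (1/ξ - 1) m_l) ≤ ε`. -/
def StopCrit (ξ ε : ℝ) {m : ℕ} (s : MainState E m) (l : Fin p) : Prop :=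
  (rank (E l) : ℝ) / ((rank (E l) : ℝ) + (1 / ξ - 1) * s.acc l) ≤ ε

variable [∀ l, FiniteDimensional ℝ (E l)]

/-- The call of the basic procedure with the orthogonal projection onto `ker A`, the starting point
`e / r` and `ξ` can return `o`. -/
def BPReturns (ξ : ℝ) {m : ℕ} (A : PiLp 2 E →ₗ[ℝ] EuclideanSpace ℝ (Fin m))
    (o : BPOutcome E) : Prop :=
  BPLoop (fun y => (LinearMap.ker A).starProjection y) ξ 1 ((1 / (totalRank E : ℝ)) • unit E) o

/-- One iteration of the main algorithm with the sum-of-eigenvalues criterion, started with the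
variables `s`: it either halts with an outcome (`Sum.inl`) or hands new values of the variables to
the next iteration (`Sum.inr`). -/
inductive MainIter (ξ ε : ℝ) {m : ℕ} : MainState E m → MainOutcome E ⊕ MainState E m → Prop
  | primal (s : MainState E m) (z : PiLp 2 E) (h : BPReturns ξ s.A (.primal z)) :
      MainIter ξ ε s (Sum.inl (.primal (blockMap s.RP z)))
  | dual (s : MainState E m) (w : PiLp 2 E) (h : BPReturns ξ s.A (.dual w)) :
      MainIter ξ ε s (Sum.inl (.dual (blockMap s.RD w)))
  | noEpsFeasible (s : MainState E m) (H : ∀ l, Finset (Fin (rank (E l))))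
      (C : ∀ l, Fin (rank (E l)) → E l) (h : BPReturns ξ s.A (.cut H C))
      (hcrit : ∃ l, (H l).Nonempty ∧ StopCrit ξ ε (s.update ξ H C) l) :
      MainIter ξ ε s (Sum.inl .noEpsFeasible)
  | rescale (s : MainState E m) (H : ∀ l, Finset (Fin (rank (E l))))
      (C : ∀ l, Fin (rank (E l)) → E l) (h : BPReturns ξ s.A (.cut H C))
      (hgo : ∀ l, (H l).Nonempty → ¬ StopCrit ξ ε (s.update ξ H C) l) :
      MainIter ξ ε s (Sum.inr (s.update ξ H C))
  | bpFailure (s : MainState E m) (h : BPReturns ξ s.A .failure) :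
      MainIter ξ ε s (Sum.inl .bpFailure)

end Product

/-- Every execution from `s` halts after at most `n` iterations of `step`: an iteration can always
be carried out (no execution gets stuck), and whenever it does not halt, the rest of the execution
halts after at most `n - 1` iterations. -/
def TerminatesWithin {S O : Type*} (step : S → O ⊕ S → Prop) : ℕ → S → Prop
  | 0, _ => False
  | n + 1, s => (∃ o, step s o) ∧ ∀ s', step s (Sum.inr s') → TerminatesWithin step n s'

end SymCone

end

/-! Fix a block with transformation `Q` (its `Qbar`) and accumulated value m, and let N be the
number of its rescalings. `Q` is a product of N quadratic representations, each of an element e +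
(ξ^(-1/2) - 1) g with g a nonempty partial sum of a Jordan frame. These factors preserve positivity
and do not decrease ⟨x, e⟩ on positive x. Hence each rescaling adds ⟨Q g, e⟩ ≥ ⟨g, e⟩ = |H| ≥ 1 to
m, and N ≤ m. As long as the criterion fails, m < T, so N ≤ ⌈T⌉ - 1. Every iteration that does not
halt rescales at least one block; summing over the blocks and adding the halting iteration gives the
first bound (`BlockInv.comp`, `MainInv.terminatesWithin`).

The second bound needs N + 1 ≤ T. For integral T this is N < T. Otherwise it follows from m ≥ N + 1,
which holds for all large N because m grows exponentially: each factor has determinant at least 1/ξ,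
so det Q ≥ (1/ξ)^N, while positivity bounds every entry of `Q` in an orthonormal basis by ⟨Q e, e⟩ =
r + (1/ξ - 1) m, so that det Q is at most a polynomial in m (`BlockInv.growth`,
`exists_forall_add_one_le`). The finitely many smaller N are covered by taking ε small. The third
claim is that a polynomial in log x is o(x).

Two algebraic facts are derived from the axioms. Every element has a spectral decomposition over a
Jordan frame of exactly `rank E` members (`exists_isSpectral`); this also shows that no execution
gets stuck. And the quadratic representations in use preserve positivity (`Pos.quadRep`), because
they send primitive idempotents to squares. -/

namespace SymCone

open EuclideanJordanAlgebra (mul one)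
open Polynomial

/-! ### Power associativity -/

section Power

variable {E : Type*} [NormedAddCommGroup E] [InnerProductSpace ℝ E] [EuclideanJordanAlgebra E]

theorem mul_one_right (x : E) : mul x one = x := by
  rw [EuclideanJordanAlgebra.mul_comm, EuclideanJordanAlgebra.one_mul]

theorem inner_mul_right (x y z : E) : inner ℝ y (mul x z) = inner ℝ (mul x y) z :=
  (EuclideanJordanAlgebra.inner_mul x y z).symm

theorem mul_isSymmetric (x : E) : (mul x : E →ₗ[ℝ] E).IsSymmetric :=
  fun y z => EuclideanJordanAlgebra.inner_mul x y z

/-- The full linearization of the Jordan identity. -/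
theorem jordan_linearized (x y z w : E) :
    mul x (mul (mul y z) w) + mul y (mul (mul x z) w) + mul z (mul (mul x y) w) =
      mul (mul y z) (mul x w) + mul (mul x z) (mul y w) + mul (mul x y) (mul z w) := by
  have J := fun u : E => EuclideanJordanAlgebra.jordan u w
  have h1 := J (x + y + z)
  have h2 := J (x + y)
  have h3 := J (y + z)
  have h4 := J (x + z)
  have h5 := J x
  have h6 := J y
  have h7 := J z
  simp only [map_add, LinearMap.add_apply, EuclideanJordanAlgebra.mul_comm y x,
    EuclideanJordanAlgebra.mul_comm z x, EuclideanJordanAlgebra.mul_comm z y]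
    at h1 h2 h3 h4 h5 h6 h7
  linear_combination (norm := module) (1 / 2 : ℝ) • (h1 - h2 - h3 - h4 + h5 + h6 + h7)

/-- The linearized Jordan identity read as an identity of operators in `z`. It yields both the
recursion for multiplications by powers and the cubic equation for multiplication by an idempotent.
-/
theorem mul_mul_mul (x y w : E) :
    (mul (mul (mul x y) w) : E →ₗ[ℝ] E) =
      mul (mul x w) ∘ₗ mul y + mul (mul y w) ∘ₗ mul x + mul (mul x y) ∘ₗ mul w
        - mul x ∘ₗ mul w ∘ₗ mul y - mul y ∘ₗ mul w ∘ₗ mul x := by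
  ext z
  have h := jordan_linearized x y z w
  simp only [EuclideanJordanAlgebra.mul_comm z, EuclideanJordanAlgebra.mul_comm _ w] at h
  rw [EuclideanJordanAlgebra.mul_comm (mul y z) (mul w x),
    EuclideanJordanAlgebra.mul_comm (mul x z) (mul w y)] at h
  simp only [LinearMap.sub_apply, LinearMap.add_apply, LinearMap.comp_apply]
  simp only [EuclideanJordanAlgebra.mul_comm _ w]
  linear_combination (norm := module) h

theorem pow_succ (x : E) (n : ℕ) : pow x (n + 1) = mul x (pow x n) := rfl

theorem pow_one (x : E) : pow x 1 = x := mul_one_right x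

theorem mul_pow_rec (x : E) (n : ℕ) :
    (mul (pow x (n + 2)) : E →ₗ[ℝ] E) =
      mul (mul x x) * mul (pow x n) + mul (pow x (n + 1)) * mul x + mul (pow x (n + 1)) * mul x
        - mul x * mul x * mul (pow x n) - mul (pow x n) * mul x * mul x := by
  have h := mul_mul_mul x (pow x n) x
  rw [EuclideanJordanAlgebra.mul_comm (pow x n) x, EuclideanJordanAlgebra.mul_comm _ x] at h
  exact h

/-- Multiplication by `x` commutes with multiplication by a power of `x`. -/
theorem commute_mul_pow (x : E) (n : ℕ) :
    Commute (mul x : Module.End ℝ E) (mul (pow x n)) := by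
  have h1 : (mul (one : E) : Module.End ℝ E) = 1 := by
    ext y; exact EuclideanJordanAlgebra.one_mul y
  have h2 : Commute (mul x : Module.End ℝ E) (mul (mul x x)) := by
    ext y; exact EuclideanJordanAlgebra.jordan x y
  -- The recursion `mul_pow_rec` reaches back two steps, so two consecutive powers are carried
  -- through the induction.
  suffices h : Commute (mul x : Module.End ℝ E) (mul (pow x n)) ∧
      Commute (mul x : Module.End ℝ E) (mul (pow x (n + 1))) from h.1
  induction n with
  | zero =>
    refine ⟨?_, ?_⟩
    · change Commute _ (mul one : Module.End ℝ E)
      rw [h1]; exact Commute.one_right _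
    · change Commute _ (mul (mul x one) : Module.End ℝ E)
      rw [mul_one_right]
  | succ n ih =>
    refine ⟨ih.2, ?_⟩
    rw [mul_pow_rec]
    have a := ih.1
    have b := ih.2
    have c := Commute.refl (mul x : Module.End ℝ E)
    exact ((((h2.mul_right a).add_right (b.mul_right c)).add_right (b.mul_right c)).sub_right
      ((c.mul_right c).mul_right a)).sub_right ((a.mul_right c).mul_right c)

/-- The value `p(x)` of a polynomial `p`. -/
noncomputable def polyEval (x : E) (p : ℝ[X]) : E := aeval (mul x : Module.End ℝ E) p one

theorem polyEval_X_pow (x : E) (n : ℕ) : polyEval x (X ^ n) = pow x n := by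
  simp only [polyEval, map_pow, aeval_X]
  induction n with
  | zero => rfl
  | succ n ih => rw [_root_.pow_succ', Module.End.mul_apply, ih]; rfl

theorem polyEval_add (x : E) (p q : ℝ[X]) : polyEval x (p + q) = polyEval x p + polyEval x q := by
  simp [polyEval]

theorem polyEval_smul (x : E) (a : ℝ) (p : ℝ[X]) : polyEval x (a • p) = a • polyEval x p := by
  simp [polyEval]

theorem polyEval_sum {ι : Type*} (x : E) (s : Finset ι) (p : ι → ℝ[X]) :
    polyEval x (∑ i ∈ s, p i) = ∑ i ∈ s, polyEval x (p i) := by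
  simp [polyEval]

theorem commute_mul_polyEval (x : E) (p : ℝ[X]) :
    Commute (mul x : Module.End ℝ E) (mul (polyEval x p)) := by
  induction p using Polynomial.induction_on' with
  | add p q hp hq =>
    rw [polyEval_add, map_add]
    exact hp.add_right hq
  | monomial n a =>
    rw [← smul_X_eq_monomial, polyEval_smul, polyEval_X_pow, map_smul]
    exact (commute_mul_pow x n).smul_right a

/-- Multiplication by `p(x)` commutes with multiplication by `x`, hence with every polynomial in the
latter; applying both operators to the identity gives the product. -/
theorem mul_polyEval (x : E) (p q : ℝ[X]) :
    mul (polyEval x p) (polyEval x q) = polyEval x (q * p) := by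
  have h : Commute (aeval (mul x : Module.End ℝ E) q) (mul (polyEval x p)) :=
    Polynomial.induction_on' (motive := fun q => Commute (aeval (mul x : Module.End ℝ E) q) _) q
      (fun q r hq hr => by rw [map_add]; exact hq.add_left hr)
      (fun n a => by
        rw [← smul_X_eq_monomial, map_smul, map_pow, aeval_X]
        exact ((commute_mul_polyEval x p).pow_left n).smul_left a)
  have h' := LinearMap.congr_fun h.eq one
  simp only [Module.End.mul_apply, mul_one_right] at h'
  exact h'.symm.trans (by simp only [polyEval, map_mul, Module.End.mul_apply])

end Power

/-! ### Spectral theorem with distinct eigenvalues -/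

section Spectral

variable {E : Type*} [NormedAddCommGroup E] [InnerProductSpace ℝ E] [EuclideanJordanAlgebra E]
  [FiniteDimensional ℝ E]

/-- Multiplication by `x` is self-adjoint, hence diagonalizable, so a polynomial in it depends only
on the values at its eigenvalues; these form `S`. -/
theorem exists_polyEval_congr (x : E) :
    ∃ S : Finset ℝ, ∀ p q : ℝ[X], (∀ μ ∈ S, p.eval μ = q.eval μ) → polyEval x p = polyEval x q := by
  classical
  have hT := mul_isSymmetric x
  refine ⟨Finset.univ.image (hT.eigenvalues rfl), fun p q h => ?_⟩
  have : aeval (mul x : Module.End ℝ E) p = aeval (mul x : Module.End ℝ E) q := by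
    refine (hT.eigenvectorBasis rfl).toBasis.ext fun i => ?_
    have hv := hT.hasEigenvector_eigenvectorBasis rfl i
    have hi := h (hT.eigenvalues rfl i) (Finset.mem_image_of_mem _ (Finset.mem_univ i))
    rw [OrthonormalBasis.coe_toBasis, Module.End.aeval_apply_of_hasEigenvector hv,
      Module.End.aeval_apply_of_hasEigenvector hv]
    simpa using congrArg (fun t : ℝ => t • _) hi
  rw [polyEval, this, polyEval]

/-- The spectral theorem with distinct eigenvalues: the idempotents are polynomials in `x`. -/
theorem exists_spectral_idempotents (x : E) :
    ∃ (S : Finset ℝ) (c : ℝ → E), (∀ μ ∈ S, c μ ≠ 0) ∧ (∀ μ ∈ S, mul (c μ) (c μ) = c μ) ∧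
      (∀ μ ∈ S, ∀ ν ∈ S, μ ≠ ν → mul (c μ) (c ν) = 0) ∧ ∑ μ ∈ S, c μ = one ∧
      x = ∑ μ ∈ S, μ • c μ ∧
      ∀ μ ∈ S, μ ≠ 0 → ∃ r : ℝ[X], c μ = aeval (mul x : Module.End ℝ E) r x := by
  classical
  obtain ⟨S, hS⟩ := exists_polyEval_congr x
  set c : ℝ → E := fun μ => polyEval x (Lagrange.basis S id μ) with hc
  have hinj : Set.InjOn (id : ℝ → ℝ) S := Function.injective_id.injOn
  have hself : ∀ μ ∈ S, (Lagrange.basis S id μ).eval μ = 1 := fun μ hμ => by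
    simpa using Lagrange.eval_basis_self hinj hμ
  have hne : ∀ μ ν, ν ∈ S → μ ≠ ν → (Lagrange.basis S id μ).eval ν = 0 := fun μ ν hν h => by
    simpa using Lagrange.eval_basis_of_ne (v := (id : ℝ → ℝ)) h hν
  -- An eigenvalue of multiplication by `x` need not be an eigenvalue of `x`; those that are not
  -- have a vanishing Lagrange idempotent and are discarded.
  have hfil : ∀ f : ℝ → ℝ, ∑ μ ∈ S.filter (fun μ => c μ ≠ 0), f μ • c μ = ∑ μ ∈ S, f μ • c μ := by
    intro f
    refine Finset.sum_filter_of_ne fun μ _ h h0 => h (by rw [h0, smul_zero])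
  have hsum : ∀ f : ℝ[X], polyEval x f = ∑ μ ∈ S, f.eval μ • c μ := by
    intro f
    simp only [hc, ← polyEval_smul, ← polyEval_sum]
    refine hS _ _ fun ν hν => ?_
    rw [eval_finsetSum, Finset.sum_eq_single ν]
    · simp [hself ν hν]
    · intro μ _ h; simp [hne μ ν hν h]
    · exact fun h => absurd hν h
  refine ⟨S.filter (fun μ => c μ ≠ 0), c, fun μ hμ => (Finset.mem_filter.1 hμ).2,
    ?_, ?_, ?_, ?_, ?_⟩
  · intro μ hμ
    rw [hc]
    simp only [mul_polyEval]
    refine hS _ _ fun ν hν => ?_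
    by_cases h : μ = ν
    · subst h; simp [hself μ hν]
    · simp [hne μ ν hν h]
  · intro μ hμ ν hν hμν
    have h0 : polyEval x (0 : ℝ[X]) = 0 := by simp [polyEval]
    rw [hc]
    simp only [mul_polyEval]
    rw [← h0]
    refine hS _ _ fun κ hκ => ?_
    by_cases h : μ = κ
    · subst h; simp [hne ν μ hκ hμν.symm]
    · simp [hne μ κ hκ h]
  · have := hsum 1
    have h1 := hfil 1
    simp only [Pi.one_apply, one_smul, eval_one] at this h1
    rw [h1, ← this]
    simp [polyEval]
  · have := hsum X
    have h1 := hfil id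
    simp only [id, eval_X] at this h1
    rw [h1, ← this]
    simp [polyEval, mul_one_right]
  · intro μ hμ h0
    refine ⟨μ⁻¹ • Lagrange.basis S id μ, ?_⟩
    have : c μ = polyEval x ((μ⁻¹ • Lagrange.basis S id μ) * X) := by
      refine hS _ _ fun ν hν => ?_
      by_cases h : μ = ν
      · subst h; simp [h0, hself μ hν]
      · simp [hne μ ν hν h]
    rw [this, polyEval, map_mul, Module.End.mul_apply, aeval_X, mul_one_right]

end Spectral

/-! ### Peirce decomposition with respect to an idempotent -/

section Peirce

variable {E : Type*} [NormedAddCommGroup E] [InnerProductSpace ℝ E] [EuclideanJordanAlgebra E]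
  {c : E}

namespace IsIdem

theorem cubic (hc : IsIdem c) (x : E) :
    (2 : ℝ) • mul c (mul c (mul c x)) = (3 : ℝ) • mul c (mul c x) - mul c x := by
  have h := LinearMap.congr_fun (mul_mul_mul c c c) x
  rw [IsIdem] at hc
  simp only [hc, LinearMap.sub_apply, LinearMap.add_apply, LinearMap.comp_apply] at h
  linear_combination (norm := module) h

/-- Multiplications by elements of the Peirce spaces for `0` and `1` commute with that by `c`. -/
theorem mul_left_comm (hc : IsIdem c) {y : E} (hy : mul c y = y ∨ mul c y = 0) (w : E) :
    mul c (mul y w) = mul y (mul c w) := by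
  have h := jordan_linearized c c y w
  rw [IsIdem] at hc
  rcases hy with hy | hy <;> simp only [hc, hy, map_zero, LinearMap.zero_apply] at h
  · linear_combination (norm := module) h
  · linear_combination (norm := module) -h

theorem mul_eq_zero (hc : IsIdem c) {x y : E} (hx : mul c x = x) (hy : mul c y = 0) :
    mul x y = 0 := by
  have h1 := hc.mul_left_comm (Or.inl hx) y
  have h2 := hc.mul_left_comm (Or.inr hy) x
  rw [hy, map_zero] at h1
  rw [hx, EuclideanJordanAlgebra.mul_comm y x] at h2
  rw [← h2, h1]

/-- The conclusion expresses that `mul x y` has no component in the Peirce space for 1/2. -/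
theorem mul_half_half (hc : IsIdem c) {x y : E} (hx : mul c x = (1 / 2 : ℝ) • x)
    (hy : mul c y = (1 / 2 : ℝ) • y) : mul c (mul c (mul x y)) = mul c (mul x y) := by
  have h := jordan_linearized x y c c
  rw [IsIdem] at hc
  simp only [hc, hx, hy, EuclideanJordanAlgebra.mul_comm x c, EuclideanJordanAlgebra.mul_comm y c,
    EuclideanJordanAlgebra.mul_comm (mul x y) c, map_smul, LinearMap.smul_apply,
    EuclideanJordanAlgebra.mul_comm y x] at h
  linear_combination (norm := module) h

/-- By `cubic`, multiplication by `c` has eigenvalues among 1, 1/2, 0. The projections here and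
below are the Lagrange polynomials 2t² - t, 4t - 4t² and 1 - 3t + 2t² at these nodes. -/
theorem peirce_one (hc : IsIdem c) (x : E) :
    mul c ((2 : ℝ) • mul c (mul c x) - mul c x) = (2 : ℝ) • mul c (mul c x) - mul c x := by
  rw [map_sub, map_smul]
  linear_combination (norm := module) hc.cubic x

theorem peirce_half (hc : IsIdem c) (x : E) :
    mul c ((4 : ℝ) • mul c x - (4 : ℝ) • mul c (mul c x)) =
      (1 / 2 : ℝ) • ((4 : ℝ) • mul c x - (4 : ℝ) • mul c (mul c x)) := by
  rw [map_sub, map_smul, map_smul]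
  linear_combination (norm := module) (-2 : ℝ) • hc.cubic x

theorem peirce_zero (hc : IsIdem c) (x : E) :
    mul c (x - (3 : ℝ) • mul c x + (2 : ℝ) • mul c (mul c x)) = 0 := by
  rw [map_add, map_sub, map_smul, map_smul]
  linear_combination (norm := module) hc.cubic x

theorem peirce_decomposition (hc : IsIdem c) (x : E) : ∃ x₁ xh x₀ : E,
    x = x₁ + xh + x₀ ∧ mul c x₁ = x₁ ∧ mul c xh = (1 / 2 : ℝ) • xh ∧ mul c x₀ = 0 :=
  ⟨_, _, _, by module, hc.peirce_one x, hc.peirce_half x, hc.peirce_zero x⟩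

/-- The difference of the two sides is the squared norm of the component of `x` in the Peirce space
for 1. `sq_norm_mul_le` comes in the same way from the component for 1/2. -/
theorem inner_mul_le (hc : IsIdem c) (x : E) : inner ℝ (mul c x) x ≤ 2 * ‖mul c x‖ ^ 2 := by
  have h : ∀ y, mul c y = y →
      inner ℝ ((2 : ℝ) • mul c (mul c x) - mul c x) y = inner ℝ x y := fun y hy => by
    simp only [inner_sub_left, real_inner_smul_left, EuclideanJordanAlgebra.inner_mul, hy]
    ring
  have h1 := real_inner_self_nonneg (x := (2 : ℝ) • mul c (mul c x) - mul c x)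
  rw [h _ (hc.peirce_one x), inner_sub_right, real_inner_smul_right, inner_mul_right,
    real_inner_self_eq_norm_sq, real_inner_comm] at h1
  linarith

theorem sq_norm_mul_le (hc : IsIdem c) (x : E) : ‖mul c x‖ ^ 2 ≤ inner ℝ (mul c x) x := by
  have h : ∀ y, mul c y = (1 / 2 : ℝ) • y →
      inner ℝ ((4 : ℝ) • mul c x - (4 : ℝ) • mul c (mul c x)) y = inner ℝ x y := fun y hy => by
    simp only [inner_sub_left, real_inner_smul_left, EuclideanJordanAlgebra.inner_mul, hy,
      real_inner_smul_right]
    ring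
  have h1 := real_inner_self_nonneg (x := (4 : ℝ) • mul c x - (4 : ℝ) • mul c (mul c x))
  rw [h _ (hc.peirce_half x), inner_sub_right, real_inner_smul_right, real_inner_smul_right,
    inner_mul_right c x (mul c x), real_inner_self_eq_norm_sq, real_inner_comm] at h1
  linarith

theorem inner_mul_nonneg (hc : IsIdem c) (x : E) : 0 ≤ inner ℝ (mul c x) x :=
  (sq_nonneg _).trans (hc.sq_norm_mul_le x)

theorem quadRep_eq (hc : IsIdem c) (s : ℝ) (x : E) :
    quadRep (one + s • c) x = x + (2 * s - s ^ 2) • mul c x + (2 * s ^ 2) • mul c (mul c x) := by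
  rw [IsIdem] at hc
  simp only [quadRep, LinearMap.sub_apply, LinearMap.smul_apply, LinearMap.comp_apply, map_add,
    LinearMap.add_apply, map_smul, EuclideanJordanAlgebra.one_mul, mul_one_right, hc]
  module

theorem quadRep_peirce (hc : IsIdem c) (t : ℝ) {x x₁ xh x₀ : E} (hx : x = x₁ + xh + x₀)
    (h1 : mul c x₁ = x₁) (hh : mul c xh = (1 / 2 : ℝ) • xh) (h0 : mul c x₀ = 0) :
    quadRep (one + (t - 1) • c) x = (t ^ 2) • x₁ + t • xh + x₀ := by
  rw [hc.quadRep_eq, hx]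
  simp only [map_add, h1, hh, h0, map_smul, map_zero]
  module

/-- The image of an idempotent `d` with `P(d) c = α d` under `P(e + (t - 1) c)` is a multiple of an
idempotent. -/
theorem mul_self_quadRep (hc : IsIdem c) {d : E} (hd : IsIdem d) {α : ℝ}
    (hα : quadRep d c = α • d) (t : ℝ) :
    mul (quadRep (one + (t - 1) • c) d) (quadRep (one + (t - 1) • c) d) =
      (t ^ 2 * α + (1 - α)) • quadRep (one + (t - 1) • c) d := by
  obtain ⟨x, y, z, hxyz, hx, hy, hz⟩ := hc.peirce_decomposition d
  rw [hc.quadRep_peirce t hxyz hx hy hz]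
  have cxx : mul c (mul x x) = mul x x := by rw [hc.mul_left_comm (Or.inl hx), hx]
  have czz : mul c (mul z z) = 0 := by rw [hc.mul_left_comm (Or.inr hz), hz, map_zero]
  have cxy : mul c (mul x y) = (1 / 2 : ℝ) • mul x y := by
    rw [hc.mul_left_comm (Or.inl hx), hy, map_smul]
  have czy : mul c (mul z y) = (1 / 2 : ℝ) • mul z y := by
    rw [hc.mul_left_comm (Or.inr hz), hy, map_smul]
  have cyy := hc.mul_half_half hy hy
  have xz := hc.mul_eq_zero hx hz
  have hdd : mul d d = d := hd
  -- `I0` is d² = d and `J0` below is P(d) c = α d. Applying multiplication by `c` twice to each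
  -- separates the Peirce components, which gives `k1` to `k6` and then all products of `x`, `y`,
  -- `z` in terms of α.
  have I0 : x + y + z = mul x x + mul z z + mul y y + (2 : ℝ) • mul x y + (2 : ℝ) • mul z y := by
    rw [← hxyz, ← hdd, hxyz]
    simp only [map_add, LinearMap.add_apply, EuclideanJordanAlgebra.mul_comm z x, xz,
      EuclideanJordanAlgebra.mul_comm y]
    module
  have I1 := congrArg (mul c) I0
  simp only [map_add, map_smul, hx, hy, hz, cxx, czz, cxy, czy] at I1
  have I2 := congrArg (mul c) I1
  simp only [map_add, map_smul, hx, hy, cxx, cxy, czy, cyy, map_zero] at I2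
  have J0 : (2 : ℝ) • mul x x + (3 : ℝ) • mul x y + mul y y + mul z y - x - (1 / 2 : ℝ) • y =
      α • (x + y + z) := by
    rw [← hxyz, ← hα]
    have hdc : mul d c = x + (1 / 2 : ℝ) • y := by
      rw [EuclideanJordanAlgebra.mul_comm, hxyz]; simp only [map_add, hx, hy, hz, add_zero]
    simp only [quadRep, LinearMap.sub_apply, LinearMap.smul_apply, LinearMap.comp_apply, hdd, hdc]
    rw [hxyz]
    simp only [map_add, LinearMap.add_apply, EuclideanJordanAlgebra.mul_comm z x, xz,
      EuclideanJordanAlgebra.mul_comm y, map_smul]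
    module
  have J1 := congrArg (mul c) J0
  simp only [map_add, map_sub, map_smul, hx, hy, hz, cxx, cxy, czy] at J1
  have J2 := congrArg (mul c) J1
  simp only [map_add, map_sub, map_smul, hx, hy, cxx, cxy, czy, cyy, map_zero] at J2
  have k1 : mul x x + mul c (mul y y) = x := by
    linear_combination (norm := module) I1 - (2 : ℝ) • I2
  have k2 : (2 : ℝ) • mul x x + mul c (mul y y) - x = α • x := by
    linear_combination (norm := module) (2 : ℝ) • J2 - J1
  have k3 : (2 : ℝ) • mul x y + (2 : ℝ) • mul z y = y := by
    linear_combination (norm := module) (4 : ℝ) • (I2 - I1)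
  have k4 : (3 : ℝ) • mul x y + mul z y - (1 / 2 : ℝ) • y = α • y := by
    linear_combination (norm := module) (4 : ℝ) • (J1 - J2)
  have k5 : mul z z + mul y y - mul c (mul y y) = z := by
    linear_combination (norm := module) (3 : ℝ) • I1 - I0 - (2 : ℝ) • I2
  have k6 : mul y y - mul c (mul y y) = α • z := by
    linear_combination (norm := module) J0 - (3 : ℝ) • J1 + (2 : ℝ) • J2
  simp only [map_add, LinearMap.add_apply, map_smul, LinearMap.smul_apply,
    EuclideanJordanAlgebra.mul_comm z x, xz, EuclideanJordanAlgebra.mul_comm y]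
  have e1 : mul x x = α • x := by linear_combination (norm := module) k2 - k1
  have e2 : mul y y = (1 - α) • x + α • z := by
    linear_combination (norm := module) k1 + k6 - e1
  have e3 : mul z z = (1 - α) • z := by linear_combination (norm := module) k5 - k6
  have e4 : mul x y = (α / 2) • y := by
    linear_combination (norm := module) (1 / 2 : ℝ) • k4 - (1 / 4 : ℝ) • k3
  have e5 : mul z y = ((1 - α) / 2) • y := by
    linear_combination (norm := module) (1 / 2 : ℝ) • k3 - e4
  rw [e1, e2, e3, e4, e5]
  module

end IsIdem

end Peirce

/-! ### Rank and Jordan frames of maximal size -/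

section Rank

variable {E : Type*} [NormedAddCommGroup E] [InnerProductSpace ℝ E] [EuclideanJordanAlgebra E]

/-- A complete system of nonzero orthogonal idempotents. -/
structure IsIdemSystem {ι : Type*} [Fintype ι] (c : ι → E) : Prop where
  idem : ∀ i, mul (c i) (c i) = c i
  ne_zero : ∀ i, c i ≠ 0
  orth : ∀ i j, i ≠ j → mul (c i) (c j) = 0
  sum_eq : ∑ i, c i = one

namespace IsIdemSystem

variable {ι : Type*} [Fintype ι] {c : ι → E}

theorem mul_sum_smul (hc : IsIdemSystem c) (a : ι → ℝ) (j : ι) :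
    mul (c j) (∑ i, a i • c i) = a j • c j := by
  classical
  rw [map_sum, Finset.sum_eq_single j]
  · rw [map_smul, hc.idem]
  · intro i _ h; rw [map_smul, hc.orth j i h.symm, smul_zero]
  · intro h; exact absurd (Finset.mem_univ j) h

theorem linearIndependent (hc : IsIdemSystem c) : LinearIndependent ℝ c := by
  rw [Fintype.linearIndependent_iff]
  intro g hg i
  have h := hc.mul_sum_smul g i
  rw [hg, map_zero] at h
  exact (smul_eq_zero.1 h.symm).resolve_right (hc.ne_zero i)

theorem pow_sum_smul (hc : IsIdemSystem c) (a : ι → ℝ) (n : ℕ) :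
    pow (∑ i, a i • c i) n = ∑ i, a i ^ n • c i := by
  induction n with
  | zero => simp [pow, hc.sum_eq]
  | succ n ih =>
    rw [pow_succ, ih, map_sum]
    refine Finset.sum_congr rfl fun i _ => ?_
    rw [map_smul, EuclideanJordanAlgebra.mul_comm, hc.mul_sum_smul, smul_smul, _root_.pow_succ]

theorem mul_self_sum_smul (hc : IsIdemSystem c) (a : ι → ℝ) :
    mul (∑ i, a i • c i) (∑ i, a i • c i) = ∑ i, a i ^ 2 • c i := by
  rw [← hc.pow_sum_smul a 2, pow_succ, pow_one]

theorem inner_eq (hc : IsIdemSystem c) (a : ι → ℝ) (j : ι) :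
    inner ℝ (∑ i, a i • c i) (c j) = a j * ‖c j‖ ^ 2 := by
  have h : inner ℝ (∑ i, a i • c i) (c j) = inner ℝ (mul (c j) (∑ i, a i • c i)) (c j) := by
    rw [EuclideanJordanAlgebra.inner_mul, hc.idem]
  rw [h, hc.mul_sum_smul, real_inner_smul_left, real_inner_self_eq_norm_sq]

end IsIdemSystem

/-- In the independent family `c` the powers have a Vandermonde matrix as coordinates. -/
theorem IsIdemSystem.linearIndependent_pow {k : ℕ} {c : Fin k → E} (hc : IsIdemSystem c)
    {a : Fin k → ℝ} (ha : Function.Injective a) :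
    LinearIndependent ℝ (fun i : Fin k => pow (∑ i, a i • c i) i) := by
  rw [Fintype.linearIndependent_iff]
  intro g hg
  simp only [hc.pow_sum_smul, Finset.smul_sum, smul_smul] at hg
  rw [Finset.sum_comm] at hg
  simp only [← Finset.sum_smul] at hg
  have h := Fintype.linearIndependent_iff.1 hc.linearIndependent _ hg
  have : g = 0 := Matrix.eq_zero_of_forall_index_sum_pow_mul_eq_zero ha fun j => by
    rw [← h j]; exact Finset.sum_congr rfl fun i _ => _root_.mul_comm _ _
  exact fun i => congrFun this i

theorem IsJordanFrame.isIdemSystem {k : ℕ} {c : Fin k → E} (hc : IsJordanFrame c) :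
    IsIdemSystem c :=
  ⟨fun i => (hc.primitive i).1, fun i => (hc.primitive i).2.1, hc.orth, hc.sum_eq⟩

theorem norm_le_of_idem {c : E} (h : mul c c = c) : ‖c‖ ≤ ‖(one : E)‖ := by
  have h1 : ‖c‖ ^ 2 = inner ℝ c one := by
    rw [← real_inner_self_eq_norm_sq]
    conv_rhs => rw [← h, EuclideanJordanAlgebra.inner_mul, mul_one_right]
  have h2 := real_inner_le_norm c one
  rcases (norm_nonneg c).eq_or_lt with h0 | h0
  · rw [← h0]; exact norm_nonneg _
  · nlinarith

variable [FiniteDimensional ℝ E]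

theorem finrank_mem_degree_set (x : E) :
    Module.finrank ℝ E ∈ {d : ℕ | ¬ LinearIndependent ℝ (fun i : Fin (d + 1) => pow x i)} := by
  intro h
  have := h.fintype_card_le_finrank
  simp at this

theorem le_degree {x : E} {k : ℕ} (h : LinearIndependent ℝ (fun i : Fin k => pow x i)) :
    k ≤ degree x := by
  refine le_csInf ⟨_, finrank_mem_degree_set x⟩ fun d hd => ?_
  by_contra! hlt
  exact hd (h.comp (Fin.castLE hlt) (Fin.castLE_injective _))

theorem bddAbove_degree : BddAbove (Set.range (degree : E → ℕ)) := by
  refine ⟨Module.finrank ℝ E, ?_⟩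
  rintro _ ⟨x, rfl⟩
  exact Nat.sInf_le (finrank_mem_degree_set x)

theorem degree_le_rank (x : E) : degree x ≤ rank E :=
  le_csSup bddAbove_degree ⟨x, rfl⟩

theorem IsIdemSystem.card_le_rank {k : ℕ} {c : Fin k → E} (hc : IsIdemSystem c) : k ≤ rank E :=
  (le_degree (hc.linearIndependent_pow (a := fun i => ((i : ℕ) : ℝ)) fun i j h => by
    simpa [Fin.ext_iff] using h)).trans (degree_le_rank _)

theorem exists_linearIndependent_pow :
    ∃ x : E, LinearIndependent ℝ (fun i : Fin (rank E) => pow x i) := by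
  obtain ⟨x, hx⟩ := Nat.sSup_mem (Set.range_nonempty (degree : E → ℕ)) bddAbove_degree
  refine ⟨x, ?_⟩
  change degree x = rank E at hx
  rw [← hx]
  rcases Nat.eq_zero_or_pos (degree x) with h0 | h0
  · have : IsEmpty (Fin (degree x)) := by rw [h0]; infer_instance
    exact linearIndependent_empty_type
  · have h := Nat.notMem_of_lt_sInf (show degree x - 1 < degree x by omega)
    rw [Set.mem_ofPred_eq, not_not] at h
    exact h.comp (Fin.cast (by omega)) (Fin.cast_injective _)

theorem exists_isIdemSystem (x : E) :
    ∃ (k : ℕ) (a : Fin k → ℝ) (c : Fin k → E), IsIdemSystem c ∧ x = ∑ i, a i • c i := by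
  obtain ⟨S, c, h0, h1, h2, h3, h4, -⟩ := exists_spectral_idempotents x
  let e := S.equivFin.symm
  have hs : ∀ f : ℝ → E, ∑ i, f (e i) = ∑ μ ∈ S, f μ := fun f => by
    rw [e.sum_comp (fun μ : S => f μ), Finset.sum_coe_sort S f]
  refine ⟨S.card, fun i => e i, fun i => c (e i), ⟨fun i => h1 _ (e i).2, fun i => h0 _ (e i).2,
    fun i j hij => h2 _ (e i).2 _ (e j).2 fun h => hij (e.injective (Subtype.ext h)), ?_⟩, ?_⟩
  · rw [hs c, h3]
  · rw [hs fun μ => μ • c μ, ← h4]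

/-- The powers of `x` lie in the span of its spectral idempotents, so there are at least `rank E` of
these; `card_le_rank` excludes more. -/
theorem exists_isIdemSystem_rank {x : E}
    (hx : LinearIndependent ℝ (fun i : Fin (rank E) => pow x i)) :
    ∃ (a : Fin (rank E) → ℝ) (c : Fin (rank E) → E), IsIdemSystem c ∧ x = ∑ i, a i • c i := by
  obtain ⟨k, a, c, hc, rfl⟩ := exists_isIdemSystem x
  suffices h : rank E ≤ k by
    obtain rfl := le_antisymm h hc.card_le_rank
    exact ⟨a, c, hc, rfl⟩
  have hsub : Set.range (fun i : Fin (rank E) => pow (∑ i, a i • c i) i) ⊆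
      (Submodule.span ℝ (Set.range c) : Set E) := by
    rintro _ ⟨n, rfl⟩
    simp only [hc.pow_sum_smul]
    exact Submodule.sum_mem _ fun i _ => Submodule.smul_mem _ _ (Submodule.subset_span ⟨i, rfl⟩)
  have h1 := finrank_span_eq_card hx
  have h2 := finrank_range_le_card (R := ℝ) c
  have h3 := Submodule.finrank_mono (Submodule.span_le.2 hsub)
  rw [Fintype.card_fin] at h1 h2
  rw [Set.finrank] at h2
  omega

theorem continuous_mul : Continuous fun q : E × E => mul q.1 q.2 :=
  (mul : E →ₗ[ℝ] E →ₗ[ℝ] E).toContinuousBilinearMap.continuous₂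

theorem analyticOnNhd_pow_line (x y : E) (n : ℕ) :
    AnalyticOnNhd ℝ (fun s : ℝ => pow (x + s • y) n) Set.univ := by
  induction n with
  | zero => exact analyticOnNhd_const
  | succ n ih =>
    intro s hs
    have h1 : AnalyticAt ℝ (fun s : ℝ => (x + s • y, pow (x + s • y) n)) s :=
      (analyticAt_const.add (analyticAt_id.smul analyticAt_const)).prod (ih s hs)
    exact AnalyticAt.fun_comp
      ((mul : E →ₗ[ℝ] E →ₗ[ℝ] E).toContinuousBilinearMap.analyticAt_bilinear _) h1

/-- On the line from any `x` to an element `x₀` of maximal degree, independence of the powers is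
implied by the nonvanishing of a determinant that is analytic in the parameter and equals 1 at `x₀`.
Its zeros are isolated, so points arbitrarily close to `x` qualify. -/
theorem dense_linearIndependent_pow :
    Dense {x : E | LinearIndependent ℝ (fun i : Fin (rank E) => pow x i)} := by
  obtain ⟨x₀, h₀⟩ := exists_linearIndependent_pow (E := E)
  obtain ⟨φ, hφ⟩ : ∃ φ : E →ₗ[ℝ] (Fin (rank E) → ℝ),
      ∀ i : Fin (rank E), φ (pow x₀ i) = Pi.single i 1 := by
    obtain ⟨g, hg⟩ := (Fintype.linearCombination ℝ
      (fun i : Fin (rank E) => pow x₀ i)).exists_leftInverse_of_injective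
      (LinearMap.ker_eq_bot.2 (linearIndependent_iff_injective_fintypeLinearCombination.1 h₀))
    refine ⟨g, fun i => ?_⟩
    have := LinearMap.congr_fun hg (Pi.single i 1)
    simpa [Fintype.linearCombination_apply_single] using this
  intro x
  set D : ℝ → ℝ := fun s =>
    Matrix.det (Matrix.of fun i j : Fin (rank E) => φ (pow (x + s • (x₀ - x)) i) j) with hD
  have hLI : ∀ s, D s ≠ 0 →
      LinearIndependent ℝ (fun i : Fin (rank E) => pow (x + s • (x₀ - x)) i) := by
    intro s hs
    refine LinearIndependent.of_comp φ ?_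
    exact Matrix.linearIndependent_rows_of_det_ne_zero hs
  have hana : AnalyticOnNhd ℝ D Set.univ := by
    intro s hs
    simp only [hD, Matrix.det_apply]
    refine Finset.analyticAt_fun_sum _ fun σ _ => ?_
    refine AnalyticAt.const_smul ?_
    refine Finset.analyticAt_fun_prod _ fun i _ => ?_
    have := (LinearMap.proj (R := ℝ) (φ := fun _ : Fin (rank E) => ℝ) i ∘ₗ
      φ).toContinuousLinearMap.analyticAt
      (pow (x + s • (x₀ - x)) (σ i : ℕ))
    exact AnalyticAt.fun_comp (f := fun s : ℝ => pow (x + s • (x₀ - x)) (σ i : ℕ)) this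
      (analyticOnNhd_pow_line x (x₀ - x) _ s hs)
  have h1 : D 1 = 1 := by
    have : (Matrix.of fun i j : Fin (rank E) => φ (pow (x + (1 : ℝ) • (x₀ - x)) i) j) = 1 := by
      ext i j
      rw [one_smul, add_sub_cancel, Matrix.of_apply, hφ, Matrix.one_apply, Pi.single_apply]
      simp only [eq_comm]
    rw [hD]
    simp only
    rw [this, Matrix.det_one]
  have hev : ∀ᶠ s in nhdsWithin (0 : ℝ) {0}ᶜ, D s ≠ 0 := by
    rcases (hana 0 (Set.mem_univ _)).eventually_eq_zero_or_eventually_ne_zero with h | h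
    · have := hana.eqOn_zero_of_preconnected_of_eventuallyEq_zero isPreconnected_univ
        (Set.mem_univ _) h (Set.mem_univ 1)
      rw [h1] at this
      exact absurd this one_ne_zero
    · exact h
  have hlim : Filter.Tendsto (fun s : ℝ => x + s • (x₀ - x)) (nhdsWithin (0 : ℝ) {0}ᶜ)
      (nhds x) := by
    have : Continuous fun s : ℝ => x + s • (x₀ - x) := by fun_prop
    have h := this.tendsto 0
    simp only [zero_smul, add_zero] at h
    exact h.mono_left nhdsWithin_le_nhds
  exact mem_closure_of_tendsto hlim (hev.mono fun s hs => hLI s hs)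

/-- Boundedness of the product gives ‖c‖ = ‖c ∘ c‖ ≤ M ‖c‖². The uniform lower bound keeps limits of
nonzero idempotents nonzero. -/
theorem exists_le_norm_of_idem :
    ∃ δ > 0, ∀ c : E, mul c c = c → c ≠ 0 → δ ≤ ‖c‖ := by
  set M := ‖(mul : E →ₗ[ℝ] E →ₗ[ℝ] E).toContinuousBilinearMap‖ with hM
  have hM0 : 0 ≤ M := by rw [hM]; positivity
  refine ⟨(M + 1)⁻¹, by positivity, fun c h h0 => ?_⟩
  have h1 := (mul : E →ₗ[ℝ] E →ₗ[ℝ] E).toContinuousBilinearMap.le_opNorm₂ c c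
  rw [LinearMap.toContinuousBilinearMap_apply, h] at h1
  have hc := norm_pos_iff.2 h0
  rw [inv_le_iff_one_le_mul₀ (by positivity)]
  have : 1 ≤ M * ‖c‖ := by
    by_contra! hlt
    nlinarith
  nlinarith

/-- Every element is a combination of a complete system of `rank E` orthogonal idempotents: this
holds on a dense set, and such systems form a compact set. -/
theorem exists_isIdemSystem_fin_rank (x : E) :
    ∃ (a : Fin (rank E) → ℝ) (c : Fin (rank E) → E), IsIdemSystem c ∧ x = ∑ i, a i • c i := by
  obtain ⟨δ, hδ, hδc⟩ := exists_le_norm_of_idem (E := E)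
  have hB : IsCompact (Set.pi Set.univ fun _ : Fin (rank E) =>
      Metric.closedBall (0 : E) ‖(one : E)‖) :=
    isCompact_univ_pi fun _ => isCompact_closedBall _ _
  obtain ⟨y, hy, hyx⟩ := mem_closure_iff_seq_limit.1 (dense_linearIndependent_pow x)
  choose a c hc hya using fun n => exists_isIdemSystem_rank (hy n)
  obtain ⟨b, -, φ, hφ, hb⟩ := hB.tendsto_subseq (x := c) fun n i _ => by
    simpa using norm_le_of_idem ((hc n).idem i)
  rw [tendsto_pi_nhds] at hb
  have hyφ := hyx.comp hφ.tendsto_atTop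
  have hm : ∀ i j, Filter.Tendsto (fun n => mul (c (φ n) i) (c (φ n) j)) Filter.atTop
      (nhds (mul (b i) (b j))) := fun i j =>
    (continuous_mul.tendsto (b i, b j)).comp ((hb i).prodMk_nhds (hb j))
  have hδb : ∀ i, δ ≤ ‖b i‖ := fun i =>
    ge_of_tendsto' (hb i).norm fun n => hδc _ ((hc _).idem i) ((hc _).ne_zero i)
  have hb0 : ∀ i, ‖b i‖ ^ 2 ≠ 0 := fun i => pow_ne_zero 2 (hδ.trans_le (hδb i)).ne'
  -- The coefficients of the approximating elements are given by the same formula, by `inner_eq`,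
  -- and therefore converge along with the idempotents.
  refine ⟨fun i => inner ℝ x (b i) / ‖b i‖ ^ 2, b,
    ⟨fun i => ?_, fun i h => ?_, fun i j hij => ?_, ?_⟩, ?_⟩
  · exact tendsto_nhds_unique (hm i i) ((hb i).congr fun n => ((hc _).idem i).symm)
  · exact hb0 i (by rw [h]; simp)
  · exact tendsto_nhds_unique (hm i j)
      (tendsto_const_nhds.congr fun n => ((hc _).orth i j hij).symm)
  · exact tendsto_nhds_unique (tendsto_finsetSum _ fun i _ => hb i)
      (tendsto_const_nhds.congr fun n => (hc (φ n)).sum_eq.symm)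
  · refine tendsto_nhds_unique hyφ ((tendsto_finsetSum Finset.univ fun i _ =>
      ((hyφ.inner (hb i)).div ((hb i).norm.pow 2) (hb0 i)).smul (hb i)).congr fun n => ?_)
    have h := hya (φ n)
    have hi := (hc (φ n)).inner_eq (a (φ n))
    rw [← h] at hi
    conv_rhs => rw [Function.comp_apply, h]
    refine Finset.sum_congr rfl fun i _ => ?_
    change (inner ℝ (y (φ n)) (c (φ n) i) / ‖c (φ n) i‖ ^ 2) • _ = _
    rw [hi i, mul_div_cancel_right₀ _ (pow_ne_zero 2 (norm_ne_zero_iff.2 ((hc _).ne_zero i)))]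
    rfl

/-- A complete system of idempotents of maximal size is a Jordan frame: splitting one of its members
would give a larger system. -/
theorem IsIdemSystem.isJordanFrame {c : Fin (rank E) → E} (hc : IsIdemSystem c) :
    IsJordanFrame c := by
  refine ⟨fun i => ⟨hc.idem i, hc.ne_zero i, fun a b ha hb hab => ?_⟩, hc.orth, hc.sum_eq⟩
  by_contra! h
  have hab0 : mul a b = 0 := by
    have h1 := hc.idem i
    rw [hab, map_add, map_add, LinearMap.add_apply, LinearMap.add_apply,
      EuclideanJordanAlgebra.mul_comm b a] at h1
    rw [IsIdem] at ha hb
    rw [ha, hb] at h1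
    have h2 : (2 : ℝ) • mul a b = 0 := by linear_combination (norm := module) h1
    exact (smul_eq_zero.1 h2).resolve_left two_ne_zero
  have hca : mul (c i) a = a := by
    rw [hab, map_add, LinearMap.add_apply, show mul a a = a from ha,
      EuclideanJordanAlgebra.mul_comm, hab0, add_zero]
  have hcb : mul (c i) b = b := by
    rw [hab, map_add, LinearMap.add_apply, show mul b b = b from hb, hab0, zero_add]
  have hci : IsIdem (c i) := hc.idem i
  have haj : ∀ j, j ≠ i → mul a (c j) = 0 := fun j hj =>
    hci.mul_eq_zero hca (hc.orth i j hj.symm)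
  have hbj : ∀ j, j ≠ i → mul b (c j) = 0 := fun j hj =>
    hci.mul_eq_zero hcb (hc.orth i j hj.symm)
  have key : IsIdemSystem (Fin.cons b (Function.update c i a) : Fin (rank E + 1) → E) := by
    have hu : ∀ j, j ≠ i → Function.update c i a j = c j := fun j hj =>
      Function.update_of_ne hj _ _
    have hui : Function.update c i a i = a := Function.update_self _ _ _
    have hub : ∀ j, mul b (Function.update c i a j) = 0 := fun j => by
      by_cases hj : j = i
      · subst hj; rw [hui, EuclideanJordanAlgebra.mul_comm, hab0]
      · rw [hu j hj, hbj j hj]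
    refine ⟨fun j => ?_, fun j => ?_, fun j k hjk => ?_, ?_⟩
    · refine Fin.cases hb (fun j => ?_) j
      by_cases hj : j = i
      · subst hj; rw [Fin.cons_succ, hui]; exact ha
      · rw [Fin.cons_succ, hu j hj]; exact hc.idem j
    · refine Fin.cases h.2 (fun j => ?_) j
      by_cases hj : j = i
      · subst hj; rw [Fin.cons_succ, hui]; exact h.1
      · rw [Fin.cons_succ, hu j hj]; exact hc.ne_zero j
    · induction j using Fin.cases with
      | zero =>
        induction k using Fin.cases with
        | zero => exact absurd rfl hjk
        | succ k => exact hub k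
      | succ j =>
        induction k using Fin.cases with
        | zero => rw [EuclideanJordanAlgebra.mul_comm]; exact hub j
        | succ k =>
          have hjk' : j ≠ k := fun h => hjk (by rw [h])
          rw [Fin.cons_succ, Fin.cons_succ]
          by_cases hj : j = i
          · subst hj; rw [hui, hu k hjk'.symm, haj k hjk'.symm]
          · by_cases hk : k = i
            · subst hk; rw [hui, hu j hj, EuclideanJordanAlgebra.mul_comm, haj j hj]
            · rw [hu j hj, hu k hk, hc.orth j k hjk']
    · rw [Fin.sum_univ_succ]
      simp only [Fin.cons_zero, Fin.cons_succ]
      rw [← hc.sum_eq, ← Finset.add_sum_erase _ _ (Finset.mem_univ i),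
        ← Finset.add_sum_erase _ c (Finset.mem_univ i), hui, hab,
        Finset.sum_congr rfl fun j hj => hu j (Finset.ne_of_mem_erase hj)]
      abel
  have := key.card_le_rank
  omega

theorem exists_isSpectral (x : E) : ∃ a c, IsSpectral x a c := by
  obtain ⟨a, c, hc, hx⟩ := exists_isIdemSystem_fin_rank x
  exact ⟨a, c, hc.isJordanFrame, hx⟩

end Rank

/-! ### Positivity and determinant of the quadratic representation -/

section Positive

variable {E : Type*} [NormedAddCommGroup E] [InnerProductSpace ℝ E] [EuclideanJordanAlgebra E]

theorem quadRep_isSymmetric (v : E) : (quadRep v).IsSymmetric := by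
  intro x y
  simp only [quadRep, LinearMap.sub_apply, LinearMap.smul_apply, LinearMap.comp_apply,
    inner_sub_left, inner_sub_right, real_inner_smul_left, real_inner_smul_right,
    EuclideanJordanAlgebra.inner_mul]

/-- Membership in the dual cone of the cone of squares. -/
def Pos (x : E) : Prop := ∀ w : E, 0 ≤ inner ℝ x (mul w w)

theorem Pos.smul {x : E} (hx : Pos x) {a : ℝ} (ha : 0 ≤ a) : Pos (a • x) := fun w => by
  rw [real_inner_smul_left]; exact mul_nonneg ha (hx w)

theorem Pos.sum {ι : Type*} {s : Finset ι} {x : ι → E} (hx : ∀ i ∈ s, Pos (x i)) :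
    Pos (∑ i ∈ s, x i) := fun w => by
  rw [sum_inner]; exact Finset.sum_nonneg fun i hi => hx i hi w

theorem IsIdem.pos {c : E} (hc : IsIdem c) : Pos c := fun w => by
  rw [← EuclideanJordanAlgebra.inner_mul, EuclideanJordanAlgebra.mul_comm]
  exact hc.inner_mul_nonneg w

theorem Pos.inner_idem_nonneg {x c : E} (hx : Pos x) (hc : IsIdem c) : 0 ≤ inner ℝ x c := by
  have := hx c
  rwa [show mul c c = c from hc] at this

theorem isIdem_one_sub {c : E} (hc : IsIdem c) : IsIdem (one - c) := by
  rw [IsIdem] at *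
  simp only [map_sub, LinearMap.sub_apply, mul_one_right, EuclideanJordanAlgebra.one_mul, hc]
  abel

theorem quadRep_one_add (s : ℝ) {c : E} (hc : IsIdem c) :
    quadRep (one + s • c) one = one + (2 * s + s ^ 2) • c := by
  rw [hc.quadRep_eq, mul_one_right, show mul c c = c from hc]
  module

variable [FiniteDimensional ℝ E]

/-- The Peirce space of a primitive idempotent for the eigenvalue `1` is a line. -/
theorem IsPrimitive.exists_eq_smul {d x : E} (hd : IsPrimitive d) (hx : mul d x = x) :
    ∃ α : ℝ, x = α • d := by
  obtain ⟨S, c, h0, h1, h2, -, h4, h5⟩ := exists_spectral_idempotents x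
  have hcomm : Commute (mul d : Module.End ℝ E) (mul x) := by
    ext w; exact hd.1.mul_left_comm (Or.inl hx) w
  have hdc : ∀ μ ∈ S, μ ≠ 0 → c μ = d := by
    intro μ hμ hμ0
    obtain ⟨r, hr⟩ := h5 μ hμ hμ0
    have hc : Commute (mul d : Module.End ℝ E) (aeval (mul x : Module.End ℝ E) r) :=
      Polynomial.induction_on' (motive := fun r => Commute _ (aeval (mul x : Module.End ℝ E) r)) r
        (fun p q hp hq => by rw [map_add]; exact hp.add_right hq)
        (fun n a => by
          rw [← smul_X_eq_monomial, map_smul, map_pow, aeval_X]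
          exact (hcomm.pow_right n).smul_right a)
    have hdcμ : mul d (c μ) = c μ := by
      have := LinearMap.congr_fun hc.eq x
      simp only [Module.End.mul_apply, hx] at this
      rw [hr, this]
    have hsub : IsIdem (d - c μ) := by
      rw [IsIdem]
      simp only [map_sub, LinearMap.sub_apply, hdcμ, h1 μ hμ, show mul d d = d from hd.1,
        EuclideanJordanAlgebra.mul_comm (c μ) d]
      abel
    rcases hd.2.2 (c μ) (d - c μ) (h1 μ hμ) hsub (by abel) with h | h
    · exact absurd h (h0 μ hμ)
    · exact (sub_eq_zero.1 h).symm
  -- Every spectral idempotent for a nonzero eigenvalue equals `d`, and the eigenvalue 0 contributes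
  -- nothing.
  refine ⟨∑ μ ∈ S, μ, ?_⟩
  rw [Finset.sum_smul]
  nth_rewrite 1 [h4]
  refine Finset.sum_congr rfl fun μ hμ => ?_
  by_cases h : μ = 0
  · simp [h]
  · rw [hdc μ hμ h]

theorem IsPrimitive.exists_quadRep_eq_smul {d : E} (hd : IsPrimitive d) (x : E) :
    ∃ α : ℝ, quadRep d x = α • d := by
  refine hd.exists_eq_smul ?_
  have h := hd.1.peirce_one x
  have : quadRep d x = (2 : ℝ) • mul d (mul d x) - mul d x := by
    simp only [quadRep, LinearMap.sub_apply, LinearMap.smul_apply, LinearMap.comp_apply,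
      show mul d d = d from hd.1]
  rw [this, h]

/-- `P(e + (t - 1) c)` maps a primitive idempotent to a square. -/
theorem IsPrimitive.quadRep_eq_mul_self {c d : E} (hc : IsIdem c) (hd : IsPrimitive d) {t : ℝ}
    (ht : 0 < t) : ∃ w : E, quadRep (one + (t - 1) • c) d = mul w w := by
  obtain ⟨α, hα⟩ := hd.exists_quadRep_eq_smul c
  have hdn : 0 < ‖d‖ ^ 2 := by have := norm_pos_iff.2 hd.2.1; positivity
  -- Since both `c` and `one - c` are positive, this formula places α in [0, 1]. The factor t² α +
  -- (1 - α) is then positive, and dividing the image by its square root produces `w`.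
  have hα' : α * ‖d‖ ^ 2 = inner ℝ c d := by
    rw [← real_inner_self_eq_norm_sq, ← real_inner_smul_left, ← hα, quadRep_isSymmetric]
    congr 1
    simp only [quadRep, LinearMap.sub_apply, LinearMap.smul_apply, LinearMap.comp_apply,
      show mul d d = d from hd.1]
    module
  have h0 : 0 ≤ inner ℝ c d := hc.pos.inner_idem_nonneg hd.1
  have h1 : 0 ≤ inner ℝ (one - c) d := (isIdem_one_sub hc).pos.inner_idem_nonneg hd.1
  have h2 : inner ℝ one d = ‖d‖ ^ 2 := by
    have : d = mul d d := hd.1.symm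
    conv_lhs => rw [this]
    rw [inner_mul_right, mul_one_right, real_inner_self_eq_norm_sq]
  rw [inner_sub_left, h2] at h1
  have hα0 : 0 ≤ α := by by_contra! h; nlinarith
  have hα1 : α ≤ 1 := by by_contra! h; nlinarith
  have hμ : 0 < t ^ 2 * α + (1 - α) := by
    rcases hα0.eq_or_lt with h | h
    · rw [← h]; norm_num
    · have := mul_pos (pow_pos ht 2) h; linarith
  have key := hc.mul_self_quadRep hd.1 hα t
  set q := quadRep (one + (t - 1) • c) d
  refine ⟨(√(t ^ 2 * α + (1 - α)))⁻¹ • q, ?_⟩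
  rw [map_smul, LinearMap.map_smul₂, key, smul_smul, smul_smul, ← mul_inv,
    Real.mul_self_sqrt hμ.le, inv_mul_cancel₀ hμ.ne', one_smul]

/-- By symmetry the operator can be moved onto the square, which is a nonnegative combination of
primitive idempotents; each of them is sent to a square. -/
theorem Pos.quadRep {c x : E} (hc : IsIdem c) (hx : Pos x) {t : ℝ} (ht : 0 < t) :
    Pos (quadRep (one + (t - 1) • c) x) := by
  intro w
  obtain ⟨a, d, hd, rfl⟩ := exists_isSpectral w
  rw [hd.isIdemSystem.mul_self_sum_smul, quadRep_isSymmetric, map_sum, inner_sum]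
  refine Finset.sum_nonneg fun i _ => ?_
  obtain ⟨w, hw⟩ := (hd.primitive i).quadRep_eq_mul_self hc ht
  rw [map_smul, real_inner_smul_right, hw]
  exact mul_nonneg (sq_nonneg _) (hx w)

/-- With L the multiplication by `c` and s = t - 1, the operator is 1 + 2s L + s² (2L² - L), where L
and 2L² - L are positive semidefinite. All eigenvalues are thus at least 1, and `c` is an
eigenvector for t². -/
theorem le_det_quadRep {c : E} (hc : IsIdem c) (h0 : c ≠ 0) {t : ℝ} (ht : 1 ≤ t) :
    t ^ 2 ≤ LinearMap.det (quadRep (one + (t - 1) • c)) := by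
  have hT := quadRep_isSymmetric (one + (t - 1) • c)
  have hge : ∀ i, 1 ≤ hT.eigenvalues rfl i := by
    intro i
    have h := hT.apply_eigenvectorBasis rfl i
    set x := hT.eigenvectorBasis rfl i
    have hx : ‖x‖ = 1 := (hT.eigenvectorBasis rfl).norm_eq_one i
    have h' : inner ℝ (quadRep (one + (t - 1) • c) x) x = hT.eigenvalues rfl i := by
      rw [h, real_inner_smul_left, real_inner_self_eq_norm_sq, hx]; simp
    rw [← h', hc.quadRep_eq, inner_add_left, inner_add_left, real_inner_smul_left,
      real_inner_smul_left, EuclideanJordanAlgebra.inner_mul c (mul c x) x,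
      real_inner_self_eq_norm_sq, real_inner_self_eq_norm_sq, hx]
    have h1 := hc.inner_mul_le x
    have h2 := hc.inner_mul_nonneg x
    nlinarith [mul_nonneg (sub_nonneg.2 ht) h2, mul_nonneg (sq_nonneg (t - 1)) (sub_nonneg.2 h1)]
  have hev : Module.End.HasEigenvalue (quadRep (one + (t - 1) • c) : Module.End ℝ E) (t ^ 2) := by
    refine Module.End.hasEigenvalue_of_hasEigenvector (x := c) ⟨?_, h0⟩
    rw [Module.End.mem_eigenspace_iff, hc.quadRep_eq, show mul c c = c from hc,
      show mul c c = c from hc]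
    module
  obtain ⟨i, hi⟩ := hT.exists_eigenvalues_eq rfl hev
  rw [hT.det_eq_prod_eigenvalues rfl]
  simp only [RCLike.ofReal_real_eq_id, id] at hi ⊢
  rw [← hi]
  calc hT.eigenvalues rfl i = ∏ j, if j = i then hT.eigenvalues rfl i else 1 := by simp
    _ ≤ ∏ j, hT.eigenvalues rfl j := by
      refine Finset.prod_le_prod (fun j _ => ?_) fun j _ => ?_
      · split_ifs
        · exact zero_le_one.trans (hge i)
        · exact zero_le_one
      · split_ifs with h
        · rw [h]
        · exact hge j

end Positive

/-! ### Growth of the accumulated value under rescalings -/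

section Growth

variable {E : Type*} [NormedAddCommGroup E] [InnerProductSpace ℝ E] [EuclideanJordanAlgebra E]

theorem IsIdemSystem.isIdem_sum {ι : Type*} [Fintype ι] {c : ι → E} (hc : IsIdemSystem c)
    (H : Finset ι) : IsIdem (∑ h ∈ H, c h) := by
  classical
  have h := hc.mul_self_sum_smul (fun i => if i ∈ H then 1 else 0)
  simp only [ite_pow, one_pow, ne_eq, OfNat.ofNat_ne_zero, not_false_eq_true, zero_pow, ite_smul,
    one_smul, zero_smul, Finset.sum_ite_mem, Finset.univ_inter] at h
  exact h

theorem IsIdemSystem.scaling_eq {k : ℕ} {c : Fin k → E} (hc : IsIdemSystem c) (t : ℝ)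
    (H : Finset (Fin k)) : scaling t H c = one + (t - 1) • ∑ h ∈ H, c h := by
  rw [scaling, ← hc.sum_eq, ← Finset.sum_add_sum_compl H c]
  module

theorem InnerIsTrace.inner_one (htr : InnerIsTrace E) {c : Fin (rank E) → E} (hc : IsJordanFrame c)
    (i : Fin (rank E)) : inner ℝ (c i) one = (1 : ℝ) := by
  rw [htr (c i) one (Pi.single i 1) c ⟨hc, ?_⟩]
  · simp
  · rw [mul_one_right, Finset.sum_eq_single i]
    · simp
    · intro j _ h; simp [h]
    · intro h; exact absurd (Finset.mem_univ i) h

theorem InnerIsTrace.norm_eq_one (htr : InnerIsTrace E) {c : Fin (rank E) → E}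
    (hc : IsJordanFrame c) (i : Fin (rank E)) : ‖c i‖ = 1 := by
  have h := htr.inner_one hc i
  rw [← hc.isIdemSystem.idem i, EuclideanJordanAlgebra.inner_mul, mul_one_right,
    real_inner_self_eq_norm_sq] at h
  exact (pow_eq_one_iff_of_nonneg (norm_nonneg _) two_ne_zero).1 h

theorem InnerIsTrace.inner_sum_one (htr : InnerIsTrace E) {c : Fin (rank E) → E}
    (hc : IsJordanFrame c) (H : Finset (Fin (rank E))) :
    inner ℝ (∑ h ∈ H, c h) one = (H.card : ℝ) := by
  rw [sum_inner, Finset.sum_congr rfl fun i _ => htr.inner_one hc i]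
  simp

/-- What `N` rescalings of a block guarantee for its transformation `Q` and its value `m`. -/
structure BlockInv (ξ : ℝ) (Q : E →ₗ[ℝ] E) (m : ℝ) (N : ℕ) : Prop where
  pos : ∀ x, Pos x → Pos (Q x)
  dom : ∀ x, Pos x → inner ℝ x one ≤ (inner ℝ (Q x) one : ℝ)
  trace : inner ℝ (Q one) one = (rank E : ℝ) + (1 / ξ - 1) * m
  det : (1 / ξ) ^ N ≤ LinearMap.det Q
  le : (N : ℝ) ≤ m

variable [FiniteDimensional ℝ E]

theorem InnerIsTrace.inner_one_one (htr : InnerIsTrace E) :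
    inner ℝ (one : E) one = (rank E : ℝ) := by
  obtain ⟨a, c, hc, -⟩ := exists_isSpectral (one : E)
  have h := htr.inner_sum_one hc Finset.univ
  rwa [hc.sum_eq, Finset.card_univ, Fintype.card_fin] at h

theorem BlockInv.id (htr : InnerIsTrace E) (ξ : ℝ) : BlockInv ξ (LinearMap.id : E →ₗ[ℝ] E) 0 0 where
  pos _ h := h
  dom _ _ := le_rfl
  trace := by rw [LinearMap.id_apply, htr.inner_one_one]; ring
  det := by simp
  le := by simp

/-- Everything rests on P e = e + (1/ξ - 1) g for the new factor P. Pairing with a positive x gives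
⟨P x, e⟩ ≥ ⟨x, e⟩; applying `Q` matches the growth of the trace with the increment ⟨Q g, e⟩ of `m`,
which is at least ⟨g, e⟩ = |H| ≥ 1. -/
theorem BlockInv.comp {ξ : ℝ} (hξ0 : 0 < ξ) (hξ1 : ξ < 1) (htr : InnerIsTrace E)
    {Q : E →ₗ[ℝ] E} {m : ℝ} {N : ℕ} (hQ : BlockInv ξ Q m N) {c : Fin (rank E) → E}
    (hc : IsJordanFrame c) {H : Finset (Fin (rank E))} (hH : H.Nonempty) :
    BlockInv ξ (Q ∘ₗ quadRep (scaling (√ξ)⁻¹ H c))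
      (inner ℝ (Q (∑ h ∈ H, c h)) one + m) (N + 1) := by
  rw [hc.isIdemSystem.scaling_eq]
  have hg : IsIdem (∑ h ∈ H, c h) := hc.isIdemSystem.isIdem_sum H
  have hcard : inner ℝ (∑ h ∈ H, c h) one = (H.card : ℝ) := htr.inner_sum_one hc H
  set g := ∑ h ∈ H, c h
  have hH1 : (1 : ℝ) ≤ H.card := by exact_mod_cast hH.card_pos
  have hs : 0 < √ξ := Real.sqrt_pos.2 hξ0
  have hs1 : √ξ ≤ 1 := Real.sqrt_le_one.2 hξ1.le
  have ht0 : 0 < (√ξ)⁻¹ := inv_pos.2 hs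
  have ht1 : 1 ≤ (√ξ)⁻¹ := (one_le_inv₀ hs).2 hs1
  have ht2 : ((√ξ)⁻¹) ^ 2 = 1 / ξ := by rw [inv_pow, Real.sq_sqrt hξ0.le, one_div]
  have hone : quadRep (one + ((√ξ)⁻¹ - 1) • g) one = one + (1 / ξ - 1) • g := by
    rw [quadRep_one_add _ hg, ← ht2]; module
  have h1ξ : 0 ≤ 1 / ξ - 1 := by
    rw [sub_nonneg, le_div_iff₀ hξ0]; linarith
  refine ⟨fun x hx => hQ.pos _ (hx.quadRep hg ht0), fun x hx => ?_, ?_, ?_, ?_⟩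
  · refine le_trans ?_ (hQ.dom _ (hx.quadRep hg ht0))
    rw [quadRep_isSymmetric, hone, inner_add_right, real_inner_smul_right]
    have := mul_nonneg h1ξ (hx.inner_idem_nonneg hg)
    linarith
  · rw [LinearMap.comp_apply, hone, map_add, map_smul, inner_add_left, real_inner_smul_left,
      hQ.trace]
    ring
  · rw [LinearMap.det_comp, _root_.pow_succ]
    have h0 : g ≠ 0 := by
      intro h
      rw [h, inner_zero_left] at hcard
      linarith
    have h := le_det_quadRep hg h0 ht1
    rw [ht2] at h
    exact mul_le_mul hQ.det h (by positivity) ((by positivity : (0 : ℝ) ≤ (1 / ξ) ^ N).trans hQ.det)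
  · have := hQ.dom g hg.pos
    have := hQ.le
    push_cast
    linarith

/-- Expand `x` and `y` in Jordan frames c and d, which are orthonormal, so the coefficients are at
most 1 in absolute value. The numbers ⟨Q c_i, d_j⟩ are nonnegative and add up to ⟨Q e, e⟩. -/
theorem BlockInv.abs_inner_le {ξ : ℝ} (htr : InnerIsTrace E) {Q : E →ₗ[ℝ] E} {m : ℝ} {N : ℕ}
    (hQ : BlockInv ξ Q m N) {x y : E} (hx : ‖x‖ = 1) (hy : ‖y‖ = 1) :
    |inner ℝ (Q x) y| ≤ inner ℝ (Q one) one := by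
  have hcoef : ∀ (a : Fin (rank E) → ℝ) (c : Fin (rank E) → E), IsJordanFrame c →
      ‖∑ i, a i • c i‖ = 1 → ∀ i, |a i| ≤ 1 := by
    intro a c hc h i
    have h1 := hc.isIdemSystem.inner_eq a i
    have h2 := abs_real_inner_le_norm (∑ i, a i • c i) (c i)
    rw [htr.norm_eq_one hc] at h1 h2
    rw [h1, h] at h2
    simpa using h2
  obtain ⟨a, c, hc, rfl⟩ := exists_isSpectral x
  obtain ⟨b, d, hd, rfl⟩ := exists_isSpectral y
  have h1 : inner ℝ (Q one) one = ∑ j, ∑ i, inner ℝ (Q (c i)) (d j) := by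
    simp only [← sum_inner, ← inner_sum, ← map_sum, hc.sum_eq, hd.sum_eq]
  rw [h1]
  simp only [map_sum, map_smul, sum_inner, inner_sum, real_inner_smul_left, real_inner_smul_right]
  refine (Finset.abs_sum_le_sum_abs _ _).trans (Finset.sum_le_sum fun j _ =>
    (Finset.abs_sum_le_sum_abs _ _).trans (Finset.sum_le_sum fun i _ => ?_))
  have hp : 0 ≤ inner ℝ (Q (c i)) (d j) :=
    (hQ.pos _ (IsIdem.pos (hc.isIdemSystem.idem i))).inner_idem_nonneg (hd.isIdemSystem.idem j)
  rw [abs_mul, abs_mul, abs_of_nonneg hp, ← mul_assoc]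
  exact mul_le_of_le_one_left hp
    (mul_le_one₀ (hcoef _ _ hd hy _) (abs_nonneg _) (hcoef _ _ hc hx _))

/-- The determinant forces exponential growth of `m`. -/
theorem BlockInv.growth {ξ : ℝ} (htr : InnerIsTrace E) {Q : E →ₗ[ℝ] E} {m : ℝ} {N : ℕ}
    (hQ : BlockInv ξ Q m N) :
    (1 / ξ) ^ N ≤ (Module.finrank ℝ E).factorial *
      ((rank E : ℝ) + (1 / ξ - 1) * m) ^ Module.finrank ℝ E := by
  let b := stdOrthonormalBasis ℝ E
  have h := Matrix.det_le (A := LinearMap.toMatrix b.toBasis b.toBasis Q) (abv := AbsoluteValue.abs)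
    (x := inner ℝ (Q one) one) fun i j => by
      rw [LinearMap.toMatrix_apply, b.coe_toBasis, b.coe_toBasis_repr_apply, b.repr_apply_apply,
        real_inner_comm]
      exact hQ.abs_inner_le htr (b.norm_eq_one _) (b.norm_eq_one _)
  rw [LinearMap.det_toMatrix, Fintype.card_fin, hQ.trace, nsmul_eq_mul] at h
  exact (hQ.det.trans (le_abs_self _)).trans h

/-- If m < N + 1 ≤ 2N, the bound of `growth` becomes (1/ξ)^N ≤ C N^n, which fails for large N. The
threshold is independent of `Q` and `m`, which makes ε₀ independent of 𝒜. -/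
theorem exists_forall_add_one_le {ξ : ℝ} (hξ0 : 0 < ξ) (hξ1 : ξ < 1) (htr : InnerIsTrace E) :
    ∃ N₀ : ℕ, ∀ (Q : E →ₗ[ℝ] E) (m : ℝ) (N : ℕ), BlockInv ξ Q m N → N₀ ≤ N → (N : ℝ) + 1 ≤ m := by
  set n := Module.finrank ℝ E
  have h1 : 1 < 1 / ξ := by rw [lt_div_iff₀ hξ0]; linarith
  have hr : (0 : ℝ) ≤ rank E := Nat.cast_nonneg _
  set C : ℝ := n.factorial * (2 * ((rank E : ℝ) + 1 / ξ)) ^ n with hC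
  have hC0 : 0 < C := by positivity
  have hlim := (tendsto_pow_const_div_const_pow_of_one_lt n h1).eventually
    (gt_mem_nhds (inv_pos.2 hC0))
  obtain ⟨N₀, hN₀⟩ := Filter.eventually_atTop.1 hlim
  -- The maximum with 1 ensures N + 1 ≤ 2N.
  refine ⟨max N₀ 1, fun Q m N hQ hN => ?_⟩
  by_contra! hlt
  have hN1 : (1 : ℝ) ≤ N := by exact_mod_cast (le_max_right _ _).trans hN
  have hm : 0 ≤ m := (Nat.cast_nonneg N).trans hQ.le
  have hb := hN₀ N ((le_max_left _ _).trans hN)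
  rw [div_lt_iff₀ (by positivity), inv_mul_eq_div, lt_div_iff₀ hC0] at hb
  have hbase : (rank E : ℝ) + (1 / ξ - 1) * m ≤ 2 * ((rank E : ℝ) + 1 / ξ) * N := by
    have h2 : (1 / ξ - 1) * m ≤ (1 / ξ) * (2 * N) :=
      mul_le_mul (by linarith) (by linarith) hm (by positivity)
    nlinarith
  have hg := (hQ.growth htr).trans (mul_le_mul_of_nonneg_left (pow_le_pow_left₀
    (add_nonneg hr (mul_nonneg (by linarith) hm)) hbase n) (Nat.cast_nonneg _))
  rw [mul_pow, ← mul_assoc, ← hC, _root_.mul_comm C] at hg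
  linarith

end Growth

/-! ### Executability and termination of the main algorithm -/

section Termination

variable {p : ℕ} {E : Fin p → Type*} [∀ l, NormedAddCommGroup (E l)]
  [∀ l, InnerProductSpace ℝ (E l)] [∀ l, EuclideanJordanAlgebra (E l)]

theorem BPLoop.of_cut {P : PiLp 2 E → PiLp 2 E} {ξ : ℝ} {k : ℕ} {y : PiLp 2 E}
    {o : BPOutcome E} (h : BPLoop P ξ k y o) {H : ∀ l, Finset (Fin (rank (E l)))}
    {C : ∀ l, Fin (rank (E l)) → E l} (ho : o = .cut H C) :
    (∃ l, (H l).Nonempty) ∧ ∀ l, IsJordanFrame (C l) := by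
  induction h with
  | exhausted => cases ho
  | primal => cases ho
  | dual_y => cases ho
  | dual_v => cases ho
  | cut k y lam c hk hz h0 hv hdec hH =>
    cases ho
    exact ⟨hH, fun l => (hdec l).1⟩
  | next k y u lam c lamz cz α o hk hz h0 hv hdec hH hdecz hu hu1 humin hα hloop ih => exact ih ho

variable [∀ l, FiniteDimensional ℝ (E l)]

theorem IsSimple.rank_pos {F : Type*} [NormedAddCommGroup F] [InnerProductSpace ℝ F]
    [EuclideanJordanAlgebra F] [FiniteDimensional ℝ F] (h : IsSimple F) : 0 < rank F := by
  obtain ⟨a, c, hc, -⟩ := exists_isSpectral (one : F)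
  by_contra! h0
  have : IsEmpty (Fin (rank F)) := by rw [Nat.le_zero.1 h0]; infer_instance
  have hone : (one : F) = 0 := by rw [← hc.sum_eq, Finset.univ_eq_empty, Finset.sum_empty]
  have := h.1
  obtain ⟨x, hx⟩ := exists_ne (0 : F)
  exact hx (by rw [← mul_one_right x, hone, map_zero])

theorem exists_isBlockSpectral (x : PiLp 2 E) : ∃ lam c, IsBlockSpectral x lam c := by
  choose lam c h using fun l => exists_isSpectral (x l)
  exact ⟨lam, c, h⟩

/-- An idempotent of trace one that attains the smallest eigenvalue. -/
theorem exists_idem_min (hp : 0 < p) (hsimple : ∀ l, IsSimple (E l))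
    (htrace : ∀ l, InnerIsTrace (E l)) {z : PiLp 2 E} {lam : ∀ l, Fin (rank (E l)) → ℝ}
    {c : ∀ l, Fin (rank (E l)) → E l} (h : IsBlockSpectral z lam c) :
    ∃ u : PiLp 2 E, (∀ l, IsIdem (u l)) ∧ inner ℝ (unit E) u = (1 : ℝ) ∧
      ∃ l i, inner ℝ z u = lam l i ∧ ∀ l' i', lam l i ≤ lam l' i' := by
  have : Nonempty (Σ l, Fin (rank (E l))) := ⟨⟨⟨0, hp⟩, ⟨0, (hsimple _).rank_pos⟩⟩⟩
  obtain ⟨⟨l, i⟩, -, hmin⟩ := Finset.exists_min_image (Finset.univ : Finset (Σ l, Fin (rank (E l))))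
    (fun q => lam q.1 q.2) Finset.univ_nonempty
  have hinner : ∀ x : PiLp 2 E,
      inner ℝ x (WithLp.toLp 2 (Pi.single l (c l i)) : PiLp 2 E) = inner ℝ (x l) (c l i) := by
    intro x
    rw [PiLp.inner_apply, Finset.sum_eq_single l]
    · simp
    · intro j _ hj; simp [Pi.single_eq_of_ne hj]
    · intro h; exact absurd (Finset.mem_univ l) h
  refine ⟨WithLp.toLp 2 (Pi.single l (c l i)), fun j => ?_, ?_, l, i, ?_, fun l' i' =>
    hmin ⟨l', i'⟩ (Finset.mem_univ _)⟩
  · by_cases hj : j = l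
    · subst hj
      simpa using ((h j).1.primitive i).1
    · simp [Pi.single_eq_of_ne hj, IsIdem]
  · rw [hinner, real_inner_comm]
    exact (htrace l).inner_one (h l).1 i
  · rw [hinner, (h l).2, (h l).1.isIdemSystem.inner_eq, (htrace l).norm_eq_one (h l).1]
    ring

/-- The branches of the loop are exhaustive because spectral decompositions and a minimizing
idempotent always exist. The induction is on a number `n` of steps after which the counter exceeds
its bound. -/
theorem BPLoop.exists (hp : 0 < p) (hsimple : ∀ l, IsSimple (E l))
    (htrace : ∀ l, InnerIsTrace (E l)) (P : PiLp 2 E → PiLp 2 E) (ξ : ℝ) (k : ℕ) (y : PiLp 2 E) :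
    ∃ o, BPLoop P ξ k y o := by
  obtain ⟨n, hn⟩ := exists_nat_gt ((p : ℝ) ^ 2 * (maxRank E : ℝ) ^ 2 / ξ ^ 2)
  replace hn : (p : ℝ) ^ 2 * (maxRank E : ℝ) ^ 2 / ξ ^ 2 < ((k + n : ℕ) : ℝ) :=
    hn.trans_le (by exact_mod_cast Nat.le_add_left n k)
  induction n generalizing k y with
  | zero => exact ⟨_, .exhausted k y (not_le.2 hn)⟩
  | succ n ih =>
    by_cases hk : (k : ℝ) ≤ (p : ℝ) ^ 2 * (maxRank E : ℝ) ^ 2 / ξ ^ 2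
    swap
    · exact ⟨_, .exhausted k y hk⟩
    by_cases hz : P y ∈ interior (cone E)
    · exact ⟨_, .primal k y hk hz⟩
    by_cases h0 : P y = 0
    · exact ⟨_, .dual_y k y hk hz h0⟩
    by_cases hv : y - P y ∈ cone E ∧ y - P y ≠ 0
    · exact ⟨_, .dual_v k y hk hz hv.1 hv.2⟩
    obtain ⟨lam, c, hdec⟩ := exists_isBlockSpectral (y - P y)
    by_cases hH : ∃ l, (cutSet ξ (y - P y) lam l).Nonempty
    · exact ⟨_, .cut k y lam c hk hz h0 hv hdec hH⟩
    obtain ⟨lamz, cz, hdecz⟩ := exists_isBlockSpectral (P y)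
    obtain ⟨u, hu, hu1, humin⟩ := exists_idem_min hp hsimple htrace hdecz
    obtain ⟨o, ho⟩ := ih (k + 1)
      ((inner ℝ (P u) (P u - P y) / ‖P y - P u‖ ^ 2 : ℝ) • y +
        (1 - (inner ℝ (P u) (P u - P y) / ‖P y - P u‖ ^ 2 : ℝ)) • u) (by convert hn using 2; omega)
    exact ⟨o, .next k y u lam c lamz cz _ o hk hz h0 hv hdec
      (fun l => Finset.not_nonempty_iff_eq_empty.1 fun h => hH ⟨l, h⟩) hdecz hu hu1 humin rfl ho⟩

theorem MainIter.exists (hp : 0 < p) (hsimple : ∀ l, IsSimple (E l))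
    (htrace : ∀ l, InnerIsTrace (E l)) (ξ ε : ℝ) {m : ℕ} (s : MainState E m) :
    ∃ o, MainIter ξ ε s o := by
  obtain ⟨o, ho⟩ := BPLoop.exists hp hsimple htrace
    (fun y => (LinearMap.ker s.A).starProjection y) ξ 1 ((1 / (totalRank E : ℝ)) • unit E)
  cases o with
  | primal z => exact ⟨_, .primal s z ho⟩
  | dual w => exact ⟨_, .dual s w ho⟩
  | failure => exact ⟨_, .bpFailure s ho⟩
  | cut H C =>
    by_cases h : ∃ l, (H l).Nonempty ∧ StopCrit ξ ε (s.update ξ H C) l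
    · exact ⟨_, .noEpsFeasible s H C ho h⟩
    · exact ⟨_, .rescale s H C ho fun l hl hs => h ⟨l, hl, hs⟩⟩

/-- `N l` bounds from below the number of rescalings of block `l` that led to the state `s`. -/
def MainInv (ξ ε : ℝ) {m : ℕ} (s : MainState E m) (N : Fin p → ℕ) : Prop :=
  ∀ l, BlockInv ξ (s.Qbar l) (s.acc l) (N l) ∧
    s.acc l < ξ / (1 - ξ) * (1 / ε - 1) * (rank (E l) : ℝ)

-- This is the failed criterion solved for the accumulated value, whose nonnegativity makes the
-- denominator positive.
omit [∀ l, FiniteDimensional ℝ (E l)] in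
theorem lt_of_not_stopCrit {ξ ε : ℝ} (hξ0 : 0 < ξ) (hξ1 : ξ < 1) (hε0 : 0 < ε) {m : ℕ}
    {s : MainState E m} {l : Fin p} (hr : 0 < rank (E l)) (hacc : 0 ≤ s.acc l)
    (h : ¬ StopCrit ξ ε s l) :
    s.acc l < ξ / (1 - ξ) * (1 / ε - 1) * (rank (E l) : ℝ) := by
  have hr' : (0 : ℝ) < rank (E l) := by exact_mod_cast hr
  have h1 : 0 < 1 - ξ := by linarith
  have h2 : 1 / ξ - 1 = (1 - ξ) / ξ := by field_simp
  rw [StopCrit, not_le, h2, lt_div_iff₀ (by positivity)] at h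
  have h3 : ξ / (1 - ξ) * (1 / ε - 1) * (rank (E l) : ℝ) =
      ξ * ((rank (E l) : ℝ) - ε * rank (E l)) / ((1 - ξ) * ε) := by
    field_simp
  rw [h3, lt_div_iff₀ (by positivity)]
  have h4 : ξ * (ε * ((rank (E l) : ℝ) + (1 - ξ) / ξ * s.acc l)) =
      ξ * ε * rank (E l) + s.acc l * ((1 - ξ) * ε) := by
    field_simp
  have := mul_lt_mul_of_pos_left h hξ0
  linarith

theorem MainInv.init {ξ ε : ℝ} (hξ0 : 0 < ξ) (hξ1 : ξ < 1) (hε0 : 0 < ε) (hε1 : ε < 1)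
    (hsimple : ∀ l, IsSimple (E l)) (htrace : ∀ l, InnerIsTrace (E l)) {m : ℕ}
    (A : PiLp 2 E →ₗ[ℝ] EuclideanSpace ℝ (Fin m)) :
    MainInv ξ ε (MainState.init A) fun _ => 0 := by
  refine fun l => ⟨BlockInv.id (htrace l) ξ, ?_⟩
  have hr : (0 : ℝ) < rank (E l) := by exact_mod_cast (hsimple l).rank_pos
  have h1 : 0 < ξ / (1 - ξ) := div_pos hξ0 (by linarith)
  have h2 : 0 < 1 / ε - 1 := by rw [sub_pos, lt_div_iff₀ hε0]; linarith
  exact mul_pos (mul_pos h1 h2) hr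

open Classical in
theorem MainInv.update {ξ ε : ℝ} (hξ0 : 0 < ξ) (hξ1 : ξ < 1) (hε0 : 0 < ε)
    (hsimple : ∀ l, IsSimple (E l)) (htrace : ∀ l, InnerIsTrace (E l)) {m : ℕ}
    {s : MainState E m} {N : Fin p → ℕ} (hs : MainInv ξ ε s N)
    {H : ∀ l, Finset (Fin (rank (E l)))} {C : ∀ l, Fin (rank (E l)) → E l}
    (hC : ∀ l, IsJordanFrame (C l))
    (hgo : ∀ l, (H l).Nonempty → ¬ StopCrit ξ ε (s.update ξ H C) l) :
    MainInv ξ ε (s.update ξ H C) fun l => if (H l).Nonempty then N l + 1 else N l := by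
  intro l
  by_cases hl : (H l).Nonempty
  · have hb : BlockInv ξ ((s.update ξ H C).Qbar l) ((s.update ξ H C).acc l) (N l + 1) := by
      simp only [MainState.update, if_pos hl]
      exact (hs l).1.comp hξ0 hξ1 (htrace l) (hC l) hl
    beta_reduce
    rw [if_pos hl]
    exact ⟨hb, lt_of_not_stopCrit hξ0 hξ1 hε0 (hsimple l).rank_pos
      ((Nat.cast_nonneg _).trans hb.le) (hgo l hl)⟩
  · simp only [MainState.update, if_neg hl]
    exact hs l

/-- The sum of the `N l` is a potential: it never exceeds the sum of the `B l` and increases in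
every iteration that does not halt. The strict inequality in `hn` leaves room for the halting
iteration. -/
theorem MainInv.terminatesWithin {ξ ε : ℝ} (hp : 0 < p) (hξ0 : 0 < ξ) (hξ1 : ξ < 1) (hε0 : 0 < ε)
    (hsimple : ∀ l, IsSimple (E l)) (htrace : ∀ l, InnerIsTrace (E l)) {B : Fin p → ℕ}
    (hB : ∀ l (Q : E l →ₗ[ℝ] E l) (a : ℝ) (N : ℕ), BlockInv ξ Q a N →
      a < ξ / (1 - ξ) * (1 / ε - 1) * (rank (E l) : ℝ) → N ≤ B l) {m : ℕ} (n : ℕ)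
    (s : MainState E m) (N : Fin p → ℕ) (hs : MainInv ξ ε s N) (hn : ∑ l, B l < ∑ l, N l + n) :
    TerminatesWithin (MainIter ξ ε) n s := by
  classical
  induction n generalizing s N with
  | zero =>
    have : ∑ l, N l ≤ ∑ l, B l := Finset.sum_le_sum fun l _ => hB l _ _ _ (hs l).1 (hs l).2
    omega
  | succ n ih =>
    refine ⟨MainIter.exists hp hsimple htrace ξ ε s, fun s' h => ?_⟩
    cases h with
    | rescale H C h hgo =>
      obtain ⟨⟨l₀, hl₀⟩, hC⟩ := h.of_cut rfl
      refine ih _ _ (hs.update hξ0 hξ1 hε0 hsimple htrace hC hgo) ?_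
      have : ∑ l, N l < ∑ l, if (H l).Nonempty then N l + 1 else N l :=
        Finset.sum_lt_sum (fun l _ => by split_ifs <;> omega)
          ⟨l₀, Finset.mem_univ _, by rw [if_pos hl₀]; omega⟩
      omega

end Termination

/-! ### Comparison with polynomials in the logarithm -/

theorem isLittleO_eval_log (P : Polynomial ℝ) :
    (fun x => P.eval (Real.log x)) =o[Filter.atTop] (fun x : ℝ => x) := by
  simp only [Polynomial.eval_eq_sum_range]
  exact Asymptotics.IsLittleO.fun_sum fun i _ => Real.isLittleO_pow_log_id_atTop.const_mul_left _

theorem eventually_eval_log_lt (P : Polynomial ℝ) {a : ℝ} (ha : 0 < a) (b : ℝ) :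
    ∀ᶠ ε in nhdsWithin (0 : ℝ) (Set.Ioi 0), P.eval (Real.log (1 / ε)) < a * (1 / ε) + b := by
  have h : ∀ᶠ x : ℝ in Filter.atTop, P.eval (Real.log x) < a * x + b := by
    filter_upwards [(isLittleO_eval_log P).bound (half_pos ha), Filter.eventually_gt_atTop 0,
      Filter.eventually_gt_atTop (-b / (a / 2))] with x h1 h2 h3
    rw [Real.norm_eq_abs, Real.norm_eq_abs, abs_of_pos h2] at h1
    rw [div_lt_iff₀ (half_pos ha)] at h3
    have := le_abs_self (P.eval (Real.log x))
    linarith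
  simp only [one_div]
  exact tendsto_inv_nhdsGT_zero.eventually h

end SymCone

/-! ### The iteration bounds -/

theorem mainTheorem12 {p : ℕ} (hp : 0 < p) (E : Fin p → Type*)
    [∀ l, NormedAddCommGroup (E l)] [∀ l, InnerProductSpace ℝ (E l)]
    [∀ l, FiniteDimensional ℝ (E l)] [∀ l, SymCone.EuclideanJordanAlgebra (E l)]
    (hsimple : ∀ l, SymCone.IsSimple (E l)) (htrace : ∀ l, SymCone.InnerIsTrace (E l))
    (ξ : ℝ) (hξ0 : 0 < ξ) (hξ1 : ξ < 1) :
    (∀ (m : ℕ) (A : PiLp 2 E →ₗ[ℝ] EuclideanSpace ℝ (Fin m)) (ε : ℝ), 0 < ε → ε < 1 →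
      ∃ n : ℕ,
        (n : ℤ) ≤ (∑ l, (⌈ξ / (1 - ξ) * (1 / ε - 1) * (SymCone.rank (E l) : ℝ)⌉ - 1)) + 1 ∧
        SymCone.TerminatesWithin (SymCone.MainIter ξ ε) n (SymCone.MainState.init A)) ∧
    (∃ ε₀ : ℝ, 0 < ε₀ ∧
      ∀ (m : ℕ) (A : PiLp 2 E →ₗ[ℝ] EuclideanSpace ℝ (Fin m)) (ε : ℝ), 0 < ε → ε < 1 →
        (ε ≤ ε₀ ∨
          ∀ l, ∃ j : ℤ, ξ / (1 - ξ) * (1 / ε - 1) * (SymCone.rank (E l) : ℝ) = (j : ℝ)) →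
        ∃ n : ℕ,
          (n : ℝ) ≤ ξ / (1 - ξ) * (1 / ε - 1) * (SymCone.totalRank E : ℝ) - p + 1 ∧
          SymCone.TerminatesWithin (SymCone.MainIter ξ ε) n (SymCone.MainState.init A)) ∧
    (∀ P : Polynomial ℝ, ∀ᶠ ε in nhdsWithin (0 : ℝ) (Set.Ioi 0),
      P.eval (Real.log (1 / ε)) <
        ξ / (1 - ξ) * (1 / ε - 1) * (SymCone.totalRank E : ℝ) - p + 1) := by
  have hξ : 0 < ξ / (1 - ξ) := div_pos hξ0 (by linarith)
  have hr : ∀ l, (1 : ℝ) ≤ SymCone.rank (E l) := fun l => by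
    exact_mod_cast (hsimple l).rank_pos
  have hT : ∀ ε : ℝ, 0 < ε → ε < 1 → ∀ l,
      0 < ξ / (1 - ξ) * (1 / ε - 1) * (SymCone.rank (E l) : ℝ) := fun ε hε0 hε1 l =>
    mul_pos (mul_pos hξ (by rw [sub_pos, lt_div_iff₀ hε0]; linarith)) (by linarith [hr l])
  refine ⟨fun m A ε hε0 hε1 => ?_, ?_, fun P => ?_⟩
  · refine ⟨(∑ l, (⌈ξ / (1 - ξ) * (1 / ε - 1) * (SymCone.rank (E l) : ℝ)⌉ - 1).toNat) + 1, ?_,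
      (SymCone.MainInv.init hξ0 hξ1 hε0 hε1 hsimple htrace A).terminatesWithin hp hξ0 hξ1 hε0
        hsimple htrace (B := fun l =>
          (⌈ξ / (1 - ξ) * (1 / ε - 1) * (SymCone.rank (E l) : ℝ)⌉ - 1).toNat) ?_ _ _ _ ?_⟩
    · push_cast
      refine add_le_add_left (Finset.sum_le_sum fun l _ => ?_) _
      have := Int.ceil_pos.2 (hT ε hε0 hε1 l)
      rw [Int.toNat_of_nonneg (by omega)]
    · intro l Q a N hQ ha
      have h : (N : ℤ) < ⌈ξ / (1 - ξ) * (1 / ε - 1) * (SymCone.rank (E l) : ℝ)⌉ :=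
        Int.lt_ceil.2 (by exact_mod_cast hQ.le.trans_lt ha)
      omega
    · simp
  · choose N₀ hN₀ using fun l => SymCone.exists_forall_add_one_le hξ0 hξ1 (htrace l)
    set M : ℝ := ∑ l, (N₀ l : ℝ) + 1 with hM
    have hM0 : 0 < M := by positivity
    have hMl : ∀ l, (N₀ l : ℝ) + 1 ≤ M := fun l => by
      have := Finset.single_le_sum (f := fun l => (N₀ l : ℝ)) (fun l _ => Nat.cast_nonneg _)
        (Finset.mem_univ l)
      linarith
    have hpos : 0 < 1 + M / (ξ / (1 - ξ)) := by positivity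
    -- This ε₀ is the solution of ξ/(1-ξ) (1/ε - 1) = M. For ε ≤ ε₀, as all ranks are at least 1,
    -- every T_l is at least M, which exceeds every threshold `N₀ l` by at least 1.
    refine ⟨(1 + M / (ξ / (1 - ξ)))⁻¹, inv_pos.2 hpos, fun m A ε hε0 hε1 hε => ?_⟩
    have key : ∀ l (Q : E l →ₗ[ℝ] E l) (a : ℝ) (N : ℕ), SymCone.BlockInv ξ Q a N →
        a < ξ / (1 - ξ) * (1 / ε - 1) * (SymCone.rank (E l) : ℝ) →
        (N : ℝ) + 1 ≤ ξ / (1 - ξ) * (1 / ε - 1) * (SymCone.rank (E l) : ℝ) := by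
      intro l Q a N hQ ha
      -- For small ε, numbers N of rescalings above the threshold use N + 1 ≤ m < T and those below
      -- it use N + 1 ≤ M ≤ T. For integral T, N < T suffices.
      rcases hε with hε | hε
      · rcases le_or_gt (N₀ l) N with h | h
        · exact (hN₀ l Q a N hQ h).trans ha.le
        · have h1 : (N : ℝ) + 1 ≤ M := by
            have : (N : ℝ) ≤ N₀ l := by exact_mod_cast h.le
            linarith [hMl l]
          have h2 : 1 + M / (ξ / (1 - ξ)) ≤ 1 / ε := by
            rw [one_div]
            exact (le_inv_comm₀ hε0 hpos).1 hε
          have h3 : M ≤ ξ / (1 - ξ) * (1 / ε - 1) := by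
            have : M / (ξ / (1 - ξ)) ≤ 1 / ε - 1 := by linarith
            rwa [div_le_iff₀' hξ] at this
          exact h1.trans (h3.trans (le_mul_of_one_le_right (hM0.le.trans h3) (hr l)))
      · obtain ⟨j, hj⟩ := hε l
        have h := hQ.le.trans_lt ha
        rw [hj] at h ⊢
        exact_mod_cast h
    -- The case N = 0 of `key`; it makes T - 1 nonnegative, so that its natural floor is not
    -- truncated.
    have hT1 : ∀ l, 1 ≤ ξ / (1 - ξ) * (1 / ε - 1) * (SymCone.rank (E l) : ℝ) := fun l => by
      simpa using key l _ _ _ (SymCone.BlockInv.id (htrace l) ξ) (hT ε hε0 hε1 l)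
    refine ⟨(∑ l, ⌊ξ / (1 - ξ) * (1 / ε - 1) * (SymCone.rank (E l) : ℝ) - 1⌋₊) + 1, ?_,
      (SymCone.MainInv.init hξ0 hξ1 hε0 hε1 hsimple htrace A).terminatesWithin hp hξ0 hξ1 hε0
        hsimple htrace (B := fun l =>
          ⌊ξ / (1 - ξ) * (1 / ε - 1) * (SymCone.rank (E l) : ℝ) - 1⌋₊) ?_ _ _ _ ?_⟩
    · have h : ∑ l, (⌊ξ / (1 - ξ) * (1 / ε - 1) * (SymCone.rank (E l) : ℝ) - 1⌋₊ : ℝ) ≤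
          ∑ l, (ξ / (1 - ξ) * (1 / ε - 1) * (SymCone.rank (E l) : ℝ) - 1) :=
        Finset.sum_le_sum fun l _ => Nat.floor_le (sub_nonneg.2 (hT1 l))
      rw [Finset.sum_sub_distrib, ← Finset.mul_sum] at h
      simp only [Finset.sum_const, Finset.card_univ, Fintype.card_fin, nsmul_eq_mul, mul_one] at h
      rw [SymCone.totalRank]
      push_cast
      linarith
    · intro l Q a N hQ ha
      exact Nat.le_floor (by linarith [key l Q a N hQ ha])
    · simp
  · have hR : (0 : ℝ) < SymCone.totalRank E := by
      have : SymCone.rank (E ⟨0, hp⟩) ≤ SymCone.totalRank E :=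
        Finset.single_le_sum (f := fun l => SymCone.rank (E l)) (fun l _ => Nat.zero_le _)
          (Finset.mem_univ _)
      exact_mod_cast (hsimple _).rank_pos.trans_le this
    filter_upwards [SymCone.eventually_eval_log_lt P (mul_pos hξ hR)
      (-(ξ / (1 - ξ) * SymCone.totalRank E) - p + 1)] with ε h
    refine h.trans_eq ?_
    ring
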